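/- Let $dA=\frac1\pi\,dx\,dy$ on $\mathbb C$. A Hele-Shaw potential is a function of the form $Q(z)=\Delta|z|^2+h(z)$ for $z\in\Sigma$ and $Q=+\infty$ on $\mathbb C\setminus\Sigma$, where $\Delta>0$ is a constant, $\Sigma\subset\mathbb C$ is compact, and $h$ is real-valued and harmonic in a neighbourhood of $\Sigma$. Let $\sigma$ be its equilibrium measure, i.e. the minimizer of $I_Q[\mu]=\iint\log\frac1{|z-w|}\,d\mu(z)\,d\mu(w)+\int Q\,d\mu$ over compactly supported Borel probability measures on $\mathbb C$, and let $S=\operatorname{supp}\sigma$ (the droplet). For $n\ge1$ and $\beta>0$ let $\mathbb P_n^\beta$ be the probability measure on $\mathbb C^n$ proportional to $e^{-\beta H_n}\,dA^{\otimes n}$, where $$H_n(z_1,\dots,z_n)=\sum_{i\ne j}\log\frac1{|z_i-z_j|}+n\sum_{i=1}^nQ(z_i),$$ the first sum running over ordered pairs. Let $N(p,\varepsilon)$ be the number of indices $j$ with $|z_j-p|\le\varepsilon$, and let $R_n^\beta(p)=\lim_{\varepsilon\downarrow0}\varepsilon^{-2}\,\mathbb E_n^\beta[N(p,\varepsilon)]$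 be the one-point function. **Theorem (Equicontinuity).** For all $\Delta_0>0$ and $\eta_0>0$ there is a constant $C=C(\Delta_0,\eta_0)>0$ such that the following holds for every Hele-Shaw potential $Q$ as above with $\Delta\ge\Delta_0$ and $\operatorname{dist}(S,\mathbb C\setminus\Sigma)\ge2\eta_0$. (a) For all $\beta\ge1/2$ and $n\ge1$, the limit defining $R_n^\beta(z)$ exists at every $z$ in the interior of $\Sigma$ with $\operatorname{dist}(z,\partial\Sigma)\ge\eta_0$, and for any two such points $z,w$, $$|R_n^\beta(z)-R_n^\beta(w)|\le C^\beta\,n\Delta\sqrt{n\Delta}\,|z-w|.$$ (b) Consequently the rescaled one-point functions $\rho_n^{\beta,p}(z)=\frac1{n\Delta}R_n^\beta\bigl(p+\frac z{\sqrt{n\Delta}}\bigr)$ are uniformly Lipschitz on compact sets: for every $p$ in the interior of $\Sigma$ with $\operatorname{dist}(p,\partial\Sigma)>\eta_0$ and every compact $K\subset\mathbb C$ there is $n_0$ such that for all $n\ge n_0$, all $\beta\ge1/2$ and all $z,w\in K$, $$|\rho_n^{\beta,p}(z)-\rho_n^{\beta,p}(w)|\le C^\beta|z-w|.$$ -/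

import Mathlib

open MeasureTheory Filter Topology
open scoped NNReal ENNReal

namespace HeleShaw

/-- Normalized Lebesgue measure `dA = (1/π) dx dy` on the complex plane. -/
noncomputable def dA : Measure ℂ := (NNReal.pi⁻¹ : ℝ≥0) • (volume : Measure ℂ)

open Classical in
/-- The Hele-Shaw potential `Q = Δ |z|² + h` on `Sig` and `Q = +∞` off `Sig`. -/
noncomputable def potential (Δ : ℝ) (h : ℂ → ℝ) (Sig : Set ℂ) (z : ℂ) : EReal :=
  if z ∈ Sig then ((Δ * ‖z‖ ^ 2 + h z : ℝ) : EReal) else ⊤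

/-- The logarithmic kernel `log (1 / |z - w|)`, equal to `+∞` on the diagonal. -/
noncomputable def logKernel (z w : ℂ) : EReal := ENNReal.log (edist z w)⁻¹

/-- Integral of an extended-real function, as the integral of the positive part minus the
integral of the negative part. It is used only for functions whose negative part has a finite
integral. -/
noncomputable def eintegral {α : Type*} [MeasurableSpace α] (μ : Measure α) (f : α → EReal) :
    EReal :=
  ((∫⁻ x, (f x).toENNReal ∂μ : ℝ≥0∞) : EReal) - ((∫⁻ x, (-f x).toENNReal ∂μ : ℝ≥0∞) : EReal)

/-- Weighted logarithmic energy `I_Q[μ] = ∬ log (1 / |z - w|) dμ(z) dμ(w) + ∫ Q dμ`. -/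
noncomputable def energy (Q : ℂ → EReal) (μ : Measure ℂ) : EReal :=
  eintegral (μ.prod μ) (fun p => logKernel p.1 p.2) + eintegral μ Q

/-- Compactly supported Borel probability measures on `ℂ`. -/
def IsCompactProb (μ : Measure ℂ) : Prop :=
  IsProbabilityMeasure μ ∧ ∃ K : Set ℂ, IsCompact K ∧ μ Kᶜ = 0

/-- `σ` is the equilibrium measure in external potential `Q`: it minimizes the weighted
energy among all compactly supported Borel probability measures. -/
def IsEquilibriumMeasure (Q : ℂ → EReal) (σ : Measure ℂ) : Prop :=
  IsCompactProb σ ∧ ∀ μ : Measure ℂ, IsCompactProb μ → energy Q σ ≤ energy Q μ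

/-- The Hamiltonian `H_n = ∑_{i ≠ j} log (1 / |z_i - z_j|) + n ∑_i Q(z_i)`; the first sum runs
over ordered pairs. -/
noncomputable def hamiltonian (Q : ℂ → EReal) (n : ℕ) (z : Fin n → ℂ) : EReal :=
  (∑ i, ∑ j ∈ Finset.univ.filter (fun j => j ≠ i), logKernel (z i) (z j))
    + (n : EReal) * ∑ i, Q (z i)

/-- The Boltzmann factor `exp (-β H_n)`. -/
noncomputable def boltzmann (Q : ℂ → EReal) (β : ℝ) (n : ℕ) (z : Fin n → ℂ) : ℝ≥0∞ :=
  EReal.exp (-((β : EReal) * hamiltonian Q n z))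

/-- The product measure `dA_n` on `ℂⁿ`. -/
noncomputable def dAn (n : ℕ) : Measure (Fin n → ℂ) := Measure.pi (fun _ => dA)

/-- The normalizing constant `Z_n^β`. -/
noncomputable def partitionFunction (Q : ℂ → EReal) (β : ℝ) (n : ℕ) : ℝ≥0∞ :=
  ∫⁻ z, boltzmann Q β n z ∂(dAn n)

/-- The Boltzmann-Gibbs measure `(1 / Z_n^β) exp (-β H_n) dA_n`. -/
noncomputable def gibbs (Q : ℂ → EReal) (β : ℝ) (n : ℕ) : Measure (Fin n → ℂ) :=
  (partitionFunction Q β n)⁻¹ • (dAn n).withDensity (boltzmann Q β n)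

open Classical in
/-- `N(p, ε)`: the number of particles in the disk with centre `p` and radius `ε`. -/
noncomputable def particleCount {n : ℕ} (p : ℂ) (ε : ℝ) (z : Fin n → ℂ) : ℕ :=
  (Finset.univ.filter (fun j => z j ∈ Metric.closedBall p ε)).card

/-- The quotient `E_n^β[N(p, ε)] / ε²`. -/
noncomputable def diskDensity (Q : ℂ → EReal) (β : ℝ) (n : ℕ) (p : ℂ) (ε : ℝ) : ℝ :=
  (∫ z, (particleCount p ε z : ℝ) ∂(gibbs Q β n)) / ε ^ 2

/-- The one-point function `R_n^β(p) = lim_{ε → 0} E_n^β[N(p, ε)] / ε²`. -/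
noncomputable def onePoint (Q : ℂ → EReal) (β : ℝ) (n : ℕ) (p : ℂ) : ℝ :=
  limUnder (𝓝[>] (0 : ℝ)) (diskDensity Q β n p)

/-- The one-point function `ρ_n^{β,p}(z) = R_n^β(p + z / √(nΔ)) / (nΔ)` of the process rescaled
about `p`. -/
noncomputable def rescaledOnePoint (Q : ℂ → EReal) (Δ β : ℝ) (n : ℕ) (p z : ℂ) : ℝ :=
  onePoint Q β n (p + z / (Real.sqrt (n * Δ) : ℂ)) / (n * Δ)

/-- The points of the interior of `Sig` at distance at least `η` from the boundary of `Sig`. -/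
def innerRegion (Sig : Set ℂ) (η : ℝ) : Set ℂ :=
  {z | z ∈ interior Sig ∧ η ≤ Metric.infDist z (frontier Sig)}

end HeleShaw

/-! Fix all particles but one. On a disk inside `Sig`, the Boltzmann factor as a function of the
free position `t` is `exp (-β n Δ |t - c|²) * |f t|^(2β)` with `f` holomorphic: the pair factors are
moduli of `t - y i`, and a harmonic function on a disk is the real part of a holomorphic one. The
centre `c` is arbitrary, since `|t|² - |t - c|²` is harmonic.

Two estimates follow, both using `2β ≥ 1`.

Regularity (`siteWeight_lipschitz`): at radius `r` with `n Δ r² ≤ 1` the Gaussian is bounded below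
by `exp (-4β)` on the disk of radius `2r`. The sub-mean value inequality and the Schwarz lemma then
bound the value and the oscillation of the weight by its integral over that disk. Integrated over
the other particles, this controls the one-point density by the expected number of particles in a
disk of microscopic radius.

Counting (`siteWeight_mul_le_lintegral`, `count_le_add`, `count_le`): if a disk of radius `s`
contains `k` other particles, moving the free particle to an annulus of radii `6s`, `7s` at least
doubles its distance to each of them. The gain is at least `exp (β k)` and the Gaussian costs at
most `exp (49 β n Δ s²)`. So the expected count in the disk is `O(1 + n Δ s²)` plus a small multiple
of the count in the disk of radius `8s`. Iterating up to a macroscopic radius, where the trivial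
bound `n` suffices, gives `O(n Δ s²)`. -/

namespace HeleShaw

open Metric Set

/-! ### Area measure and sub-mean value inequalities. -/

lemma lintegral_dA (f : ℂ → ℝ≥0∞) (s : Set ℂ) :
    ∫⁻ z in s, f z ∂dA = ENNReal.ofReal (Real.pi⁻¹) * ∫⁻ z in s, f z := by
  rw [dA, Measure.restrict_smul, lintegral_smul_measure, ENNReal.smul_def, smul_eq_mul]
  congr 1
  rw [ENNReal.ofReal, Real.toNNReal_inv]
  congr 2
  exact (Real.toNNReal_of_nonneg Real.pi_pos.le).symm

lemma dA_closedBall (p : ℂ) {r : ℝ} (hr : 0 ≤ r) :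
    dA (closedBall p r) = ENNReal.ofReal (r ^ 2) := by
  have := lintegral_dA (fun _ => 1) (closedBall p r)
  simp only [lintegral_const, one_mul, Measure.restrict_apply MeasurableSet.univ,
    Set.univ_inter, Complex.volume_closedBall] at this
  rw [this, ← ENNReal.ofReal_pow hr, mul_comm, mul_assoc, mul_comm]
  have hpi : (NNReal.pi : ℝ≥0∞) = ENNReal.ofReal Real.pi := by
    rw [ENNReal.ofReal, Real.toNNReal_of_nonneg Real.pi_pos.le]; rfl
  rw [hpi, ← ENNReal.ofReal_mul Real.pi_pos.le, mul_inv_cancel₀ Real.pi_ne_zero]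
  simp

instance : SigmaFinite dA := by unfold dA; infer_instance

/-- The `q`-th power of the modulus of a holomorphic function at the centre of a circle is at most
its mean over the circle. -/
lemma norm_rpow_mul_two_pi_le_lintegral_circle {f : ℂ → ℂ} {c : ℂ} {ρ q : ℝ} (hρ : 0 < ρ)
    (hf : DiffContOnCl ℂ f (ball c ρ)) (hq : 1 ≤ q) :
    ENNReal.ofReal (‖f c‖ ^ q * (2 * Real.pi)) ≤
      ∫⁻ θ in Ioo (-Real.pi) Real.pi,
        ENNReal.ofReal (‖f (c + ρ * (Real.cos θ + Real.sin θ * Complex.I))‖ ^ q) := by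
  have hpi := Real.pi_pos
  set φ : ℝ → ℂ := fun θ => f (c + ρ * (Real.cos θ + Real.sin θ * Complex.I)) with hφ
  have hcm : ∀ θ : ℝ, circleMap c ρ θ = c + ρ * (Real.cos θ + Real.sin θ * Complex.I) := by
    intro θ
    rw [circleMap, Complex.exp_mul_I, ← Complex.ofReal_cos, ← Complex.ofReal_sin]
  have hcont : Continuous φ := by
    have h1 : ContinuousOn f (closedBall c ρ) := by
      have := hf.continuousOn
      rwa [closure_ball c hρ.ne'] at this
    have h2 : Continuous (circleMap c ρ) := continuous_circleMap c ρ
    have h3 := h1.comp_continuous h2 (fun θ => circleMap_mem_closedBall c hρ.le θ)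
    refine h3.congr fun θ => ?_
    simp only [hφ, Function.comp, hcm]
  have hvol : volume (Ioo (-Real.pi) Real.pi) = ENNReal.ofReal (2 * Real.pi) := by
    rw [Real.volume_Ioo]; ring_nf
  have havg : f c = ⨍ θ in Ioo (-Real.pi) Real.pi, φ θ := by
    have h1 := DiffContOnCl.circleAverage (f := f) (c := c) (R := ρ) (by rwa [abs_of_pos hρ])
    rw [Real.circleAverage_eq_integral_add (-Real.pi),
      intervalIntegral.integral_comp_add_right (fun θ => f (circleMap c ρ θ))] at h1
    rw [setAverage_eq, ← h1, measureReal_def, hvol, ENNReal.toReal_ofReal (by positivity)]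
    congr 1
    rw [intervalIntegral.integral_of_le (by linarith), integral_Ioc_eq_integral_Ioo]
    simp only [hcm, hφ]
    congr 2
    congr 1 <;> ring
  have hqc : Continuous fun θ => ‖φ θ‖ ^ q :=
    hcont.norm.rpow_const fun _ => Or.inr (by linarith)
  -- Jensen's inequality for this convex function, applied to the mean value property of `f` itself,
  -- needs no discussion of the zeros of `f`; this is where `1 ≤ q` enters.
  have hconv : ConvexOn ℝ univ fun z : ℂ => ‖z‖ ^ q := by
    refine ⟨convex_univ, fun x _ y _ a b ha hb hab => ?_⟩
    refine le_trans (Real.rpow_le_rpow (norm_nonneg _)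
      ((convexOn_univ_norm (E := ℂ)).2 (mem_univ x) (mem_univ y) ha hb hab) (by linarith)) ?_
    exact (convexOn_rpow hq).2 (norm_nonneg x) (norm_nonneg y) ha hb hab
  have hint : ∀ {E : Type} [NormedAddCommGroup E] {g : ℝ → E}, Continuous g →
      IntegrableOn g (Ioo (-Real.pi) Real.pi) := fun hg =>
    (hg.continuousOn.integrableOn_compact isCompact_Icc).mono_set Ioo_subset_Icc_self
  have key := hconv.map_set_average_le (μ := volume) (t := Ioo (-Real.pi) Real.pi) (f := φ)
    (by fun_prop (disch := linarith)) isClosed_univ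
    (by rw [hvol]; simp [hpi]) (by rw [hvol]; exact ENNReal.ofReal_ne_top)
    (by simp) (hint hcont) (hint hqc)
  rw [← havg, setAverage_eq, measureReal_def, hvol, ENNReal.toReal_ofReal (by positivity),
    smul_eq_mul, inv_mul_eq_div, le_div_iff₀ (by positivity)] at key
  rw [← ofReal_integral_eq_lintegral_ofReal (hint hqc)
    (Eventually.of_forall fun θ => by positivity)]
  exact ENNReal.ofReal_le_ofReal key

/-- The sub-mean value inequality over an annulus for powers of the modulus of a holomorphic
function. -/
lemma norm_rpow_mul_le_lintegral_annulus {f : ℂ → ℂ} {U : Set ℂ} {c : ℂ} {a b q : ℝ}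
    (hf : DifferentiableOn ℂ f U) (hU : closedBall c b ⊆ U) (ha : 0 ≤ a) (hab : a ≤ b)
    (hq : 1 ≤ q) :
    ENNReal.ofReal (‖f c‖ ^ q * (b ^ 2 - a ^ 2)) ≤
      ∫⁻ z in closedBall c b \ ball c a, ENNReal.ofReal (‖f z‖ ^ q) ∂dA := by
  have hpi := Real.pi_pos
  set A := closedBall c b \ ball c a
  have hA : MeasurableSet A := measurableSet_closedBall.diff measurableSet_ball
  set g : ℂ → ℝ≥0∞ := A.indicator fun z => ENNReal.ofReal (‖f z‖ ^ q) with hg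
  have hgm : Measurable g := by
    have h1 : ContinuousOn (fun z => ENNReal.ofReal (‖f z‖ ^ q)) A := by
      refine ENNReal.continuous_ofReal.comp_continuousOn ?_
      refine ContinuousOn.rpow_const ?_ fun _ _ => Or.inr (by linarith)
      exact (hf.continuousOn.mono (sdiff_subset.trans hU)).norm
    classical
    rw [hg, ← piecewise_eq_indicator]
    exact h1.measurable_piecewise continuousOn_const hA
  -- In polar coordinates the circle inequality is multiplied by `r` and integrated over `(a, b)`,
  -- so that `2π` becomes `π (b² - a²)`.
  have key : ENNReal.ofReal (‖f c‖ ^ q * (b ^ 2 - a ^ 2)) * ENNReal.ofReal Real.pi ≤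
      ∫⁻ z, g z := by
    rw [← lintegral_add_left_eq_self g c, ← Complex.lintegral_comp_polarCoord_symm,
      polarCoord_target, Measure.volume_eq_prod, ← Measure.prod_restrict,
      lintegral_prod _ (by
        apply Measurable.aemeasurable
        simp only [smul_eq_mul, Complex.polarCoord_symm_apply]
        exact (by fun_prop : Measurable fun p : ℝ × ℝ => ENNReal.ofReal p.1).mul
          (hgm.comp (by fun_prop)))]
    calc ENNReal.ofReal (‖f c‖ ^ q * (b ^ 2 - a ^ 2)) * ENNReal.ofReal Real.pi
        = ∫⁻ r in Ioo a b, ENNReal.ofReal (r * (‖f c‖ ^ q * (2 * Real.pi))) := by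
          rw [← ofReal_integral_eq_lintegral_ofReal]
          · rw [← ENNReal.ofReal_mul' hpi.le, ← integral_Ioc_eq_integral_Ioo,
              ← intervalIntegral.integral_of_le hab, intervalIntegral.integral_mul_const,
              integral_id]
            congr 1
            ring
          · exact ((by fun_prop : Continuous fun r : ℝ => r * (‖f c‖ ^ q * (2 * Real.pi))
              ).continuousOn.integrableOn_compact isCompact_Icc).mono_set Ioo_subset_Icc_self
          · filter_upwards [ae_restrict_mem measurableSet_Ioo] with r hr
            have : 0 ≤ r := ha.trans hr.1.le
            positivity
      _ ≤ ∫⁻ r in Ioo a b, ∫⁻ θ in Ioo (-Real.pi) Real.pi,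
            ENNReal.ofReal r • g (c + Complex.polarCoord.symm (r, θ)) := by
          refine setLIntegral_mono' measurableSet_Ioo fun r hr => ?_
          have hr0 : 0 < r := ha.trans_lt hr.1
          simp only [smul_eq_mul]
          rw [lintegral_const_mul' _ _ ENNReal.ofReal_ne_top, ENNReal.ofReal_mul hr0.le]
          gcongr
          refine (norm_rpow_mul_two_pi_le_lintegral_circle hr0 (f := f) ?_ hq).trans ?_
          · refine DifferentiableOn.diffContOnCl (hf.mono ?_)
            rw [closure_ball c hr0.ne']
            exact (closedBall_subset_closedBall hr.2.le).trans hU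
          · refine lintegral_mono fun θ => ?_
            have hn : ‖(r : ℂ) * (Real.cos θ + Real.sin θ * Complex.I)‖ = r := by
              have := Complex.norm_polarCoord_symm (r, θ)
              rw [Complex.polarCoord_symm_apply] at this
              simpa only [abs_of_pos hr0] using this
            have hm : c + (r : ℂ) * (Real.cos θ + Real.sin θ * Complex.I) ∈ A := by
              refine ⟨?_, ?_⟩
              · rw [mem_closedBall, dist_self_add_left, hn]; exact hr.2.le
              · rw [mem_ball, dist_self_add_left, hn]; exact not_lt.2 hr.1.le
            rw [Complex.polarCoord_symm_apply, hg, Set.indicator_of_mem hm]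
      _ ≤ _ := lintegral_mono_set fun r hr => ha.trans_lt hr.1
  rw [lintegral_dA, ← lintegral_indicator hA]
  calc ENNReal.ofReal (‖f c‖ ^ q * (b ^ 2 - a ^ 2))
      = ENNReal.ofReal Real.pi⁻¹ *
        (ENNReal.ofReal (‖f c‖ ^ q * (b ^ 2 - a ^ 2)) * ENNReal.ofReal Real.pi) := by
        rw [mul_comm (ENNReal.ofReal _) (ENNReal.ofReal Real.pi), ← mul_assoc,
          ← ENNReal.ofReal_mul (inv_nonneg.2 hpi.le), inv_mul_cancel₀ hpi.ne',
          ENNReal.ofReal_one, one_mul]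
    _ ≤ _ := by gcongr

/-! ### Factorisation of the Boltzmann weight. -/

lemma exp_sum {ι : Type*} (s : Finset ι) (f : ι → EReal) :
    EReal.exp (∑ i ∈ s, f i) = ∏ i ∈ s, EReal.exp (f i) := by
  classical
  induction s using Finset.induction_on with
  | empty => simp
  | insert a s ha ih => rw [Finset.sum_insert ha, Finset.prod_insert ha, EReal.exp_add, ih]

open Classical in
/-- The one-particle factor `exp (-β n Q)`. -/
noncomputable def weight (Δ : ℝ) (h : ℂ → ℝ) (Sig : Set ℂ) (β : ℝ) (n : ℕ) (t : ℂ) : ℝ≥0∞ :=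
  if t ∈ Sig then ENNReal.ofReal (Real.exp (-(β * n * (Δ * ‖t‖ ^ 2 + h t)))) else 0

/-- The factor of the Boltzmann weight that depends on the particle at `t` when the other
particles are at `y`. -/
noncomputable def siteWeight (Δ : ℝ) (h : ℂ → ℝ) (Sig : Set ℂ) (β : ℝ) {m : ℕ} (y : Fin m → ℂ)
    (t : ℂ) : ℝ≥0∞ :=
  weight Δ h Sig β (m + 1) t * ∏ i, edist t (y i) ^ (2 * β)

/-- The factor of the Boltzmann weight that does not involve the distinguished particle. -/
noncomputable def restWeight (Δ : ℝ) (h : ℂ → ℝ) (Sig : Set ℂ) (β : ℝ) {m : ℕ}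
    (y : Fin m → ℂ) : ℝ≥0∞ :=
  (∏ i, ∏ j ∈ Finset.univ.filter (fun j => j ≠ i), edist (y i) (y j) ^ β) *
    ∏ i, weight Δ h Sig β (m + 1) (y i)

/-- Positivity of `β` and `n ≠ 0` make the value `+∞` of the potential off `Sig` survive both
powers, so that its inverse is `0`. -/
lemma exp_potential_inv {Δ : ℝ} {h : ℂ → ℝ} {Sig : Set ℂ} {β : ℝ} (hβ : 0 < β) {n : ℕ}
    (hn : n ≠ 0) (t : ℂ) :
    (((EReal.exp (potential Δ h Sig t)) ^ n) ^ β)⁻¹ = weight Δ h Sig β n t := by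
  unfold potential weight
  split_ifs with ht
  · rw [EReal.exp_coe, ← ENNReal.ofReal_pow (Real.exp_pos _).le, ← Real.exp_nat_mul,
      ENNReal.ofReal_rpow_of_pos (Real.exp_pos _), ← ENNReal.ofReal_inv_of_pos (by positivity),
      ← Real.exp_mul, ← Real.exp_neg]
    congr 3
    ring
  · rw [EReal.exp_top, ENNReal.top_pow hn, ENNReal.top_rpow_of_pos hβ, ENNReal.inv_top]

lemma boltzmann_eq {Δ : ℝ} {h : ℂ → ℝ} {Sig : Set ℂ} {β : ℝ} (hβ : 0 < β) {n : ℕ}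
    (hn : n ≠ 0) (z : Fin n → ℂ) :
    boltzmann (potential Δ h Sig) β n z =
      (∏ i, ∏ j ∈ Finset.univ.filter (fun j => j ≠ i), edist (z i) (z j) ^ β) *
        ∏ i, weight Δ h Sig β n (z i) := by
  -- With `hQ`, this rules out `0 * ∞` when the inverse is distributed over the products.
  have hK : ∀ i j, ((edist (z i) (z j))⁻¹ ^ β) ≠ 0 := fun i j => by
    simp [ENNReal.rpow_eq_zero_iff, edist_ne_top, hβ.not_gt]
  have hQ : ∀ i, ((EReal.exp (potential Δ h Sig (z i))) ^ n) ^ β ≠ 0 := fun i => by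
    have : potential Δ h Sig (z i) ≠ ⊥ := by
      unfold potential
      split_ifs
      · exact EReal.coe_ne_bot _
      · exact top_ne_bot
    simp [ENNReal.rpow_eq_zero_iff, hβ.not_gt, hn, this]
  rw [boltzmann, EReal.exp_neg, mul_comm, EReal.exp_mul, hamiltonian, EReal.exp_add, exp_sum,
    EReal.exp_nmul, exp_sum]
  simp only [exp_sum, logKernel, ENNReal.exp_log]
  rw [← Finset.prod_pow, ENNReal.mul_rpow_of_nonneg _ _ hβ.le,
    ← ENNReal.prod_rpow_of_nonneg hβ.le, ← ENNReal.prod_rpow_of_nonneg hβ.le]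
  simp only [← ENNReal.prod_rpow_of_nonneg hβ.le]
  rw [ENNReal.mul_inv (Or.inl (Finset.prod_ne_zero_iff.2 fun i _ =>
      Finset.prod_ne_zero_iff.2 fun j _ => hK i j))
      (Or.inr (Finset.prod_ne_zero_iff.2 fun i _ => hQ i)),
    ENNReal.prod_inv_distrib fun i _ j _ _ => Or.inl (hQ i),
    ENNReal.prod_inv_distrib fun i _ j _ _ => Or.inl
      (Finset.prod_ne_zero_iff.2 fun j _ => hK i j)]
  simp only [exp_potential_inv hβ hn]
  congr 1
  refine Finset.prod_congr rfl fun i _ => ?_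
  rw [ENNReal.prod_inv_distrib fun j _ k _ _ => Or.inl (hK i j)]
  refine Finset.prod_congr rfl fun j _ => ?_
  rw [ENNReal.inv_rpow, inv_inv]

/-- The sum over ordered pairs meets each pair twice, whence the exponent `2 * β` in `siteWeight`.
-/
lemma boltzmann_insertNth {Δ : ℝ} {h : ℂ → ℝ} {Sig : Set ℂ} {β : ℝ} (hβ : 0 < β) {m : ℕ}
    (k : Fin (m + 1)) (t : ℂ) (y : Fin m → ℂ) :
    boltzmann (potential Δ h Sig) β (m + 1) (Fin.insertNth (α := fun _ => ℂ) k t y) =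
      siteWeight Δ h Sig β y t * restWeight Δ h Sig β y := by
  rw [boltzmann_eq hβ m.succ_ne_zero, siteWeight, restWeight]
  simp only [Finset.prod_filter]
  simp only [Fin.prod_univ_succAbove _ k, Fin.insertNth_apply_same, Fin.insertNth_apply_succAbove,
    ne_eq, not_true_eq_false, if_false, one_mul, Fin.succAbove_ne, not_false_eq_true, if_true,
    Fin.succAbove_right_inj, Fin.ne_succAbove, Finset.prod_mul_distrib]
  have h2 : ∏ i, edist t (y i) ^ (2 * β) =
      (∏ i, edist t (y i) ^ β) * ∏ i, edist (y i) t ^ β := by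
    rw [← Finset.prod_mul_distrib]
    refine Finset.prod_congr rfl fun i _ => ?_
    rw [edist_comm (y i) t, ← ENNReal.rpow_add_of_nonneg _ _ hβ.le hβ.le, two_mul]
  rw [h2]
  ring

/-! ### Local holomorphic structure of the site weight. -/

/-- On a disk contained in `Sig` the one-particle factor is a Gaussian about `c` times a power of
the modulus of a holomorphic function. -/
lemma exists_weight_eq {Δ : ℝ} {h : ℂ → ℝ} {Sig : Set ℂ}
    (hh : InnerProductSpace.HarmonicOnNhd h Sig) (β : ℝ) (n : ℕ) {p : ℂ} {ρ : ℝ}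
    (hρ : ball p ρ ⊆ Sig) (c : ℂ) :
    ∃ G : ℂ → ℂ, DifferentiableOn ℂ G (ball p ρ) ∧ ∀ t ∈ ball p ρ,
      weight Δ h Sig β n t =
        ENNReal.ofReal (Real.exp (-(β * (n * Δ) * ‖t - c‖ ^ 2)) * ‖G t‖ ^ (2 * β)) := by
  obtain ⟨g, hg, hgh⟩ := InnerProductSpace.HarmonicOnNhd.exists_analyticOnNhd_ball_re_eq
    (f := h) (z := p) (R := ρ) fun x hx => hh x (hρ hx)
  -- Here `h = Re g`, and `‖t‖² = ‖c‖² + 2 Re (conj c (t - c)) + ‖t - c‖²`; the factor `n / 2`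
  -- compensates the exponent `2 * β`.
  refine ⟨fun t => Complex.exp (-(n / 2 : ℝ) * ((Δ * ‖c‖ ^ 2 : ℝ) +
    (2 * Δ : ℝ) * (starRingEnd ℂ c * (t - c)) + g t)), ?_, fun t ht => ?_⟩
  · have := hg.differentiableOn
    fun_prop
  · rw [weight, if_pos (hρ ht), Complex.norm_exp, ← Real.exp_mul, ← Real.exp_add]
    congr 2
    have h1 : (g t).re = h t := hgh ht
    have h2 : ‖t‖ ^ 2 = ‖c‖ ^ 2 + 2 * (starRingEnd ℂ c * (t - c)).re + ‖t - c‖ ^ 2 := by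
      simp only [← Complex.normSq_eq_norm_sq, Complex.normSq_apply, Complex.mul_re,
        Complex.conj_re, Complex.conj_im, Complex.sub_re, Complex.sub_im]
      ring
    rw [← Complex.ofReal_neg, Complex.re_ofReal_mul, Complex.add_re, Complex.add_re,
      Complex.ofReal_re, Complex.re_ofReal_mul, h1, h2]
    ring

lemma edist_rpow_eq {β : ℝ} (hβ : 0 ≤ β) (t w : ℂ) :
    edist t w ^ (2 * β) = ENNReal.ofReal (‖t - w‖ ^ (2 * β)) := by
  rw [edist_dist, dist_eq_norm, ENNReal.ofReal_rpow_of_nonneg (norm_nonneg _) (by positivity)]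

/-- The site weight is a Gaussian about `c` times a power of the modulus of a holomorphic
function; the particles in `I` contribute explicit factors. -/
lemma exists_siteWeight_eq {Δ : ℝ} {h : ℂ → ℝ} {Sig : Set ℂ}
    (hh : InnerProductSpace.HarmonicOnNhd h Sig) {β : ℝ} (hβ : 0 ≤ β) {m : ℕ} {p : ℂ} {ρ : ℝ}
    (hρ : ball p ρ ⊆ Sig) (c : ℂ) (y : Fin m → ℂ) (I : Finset (Fin m)) :
    ∃ f : ℂ → ℂ, DifferentiableOn ℂ f (ball p ρ) ∧ ∀ t ∈ ball p ρ,
      siteWeight Δ h Sig β y t =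
        ENNReal.ofReal (Real.exp (-(β * ((m + 1 : ℕ) * Δ) * ‖t - c‖ ^ 2)) *
          ((∏ i ∈ I, ‖t - y i‖) ^ (2 * β) * ‖f t‖ ^ (2 * β))) := by
  obtain ⟨G, hG, hGw⟩ := exists_weight_eq (Δ := Δ) hh β (m + 1) hρ c
  refine ⟨fun t => (∏ i ∈ Iᶜ, (t - y i)) * G t, ?_, fun t ht => ?_⟩
  · refine DifferentiableOn.mul ?_ hG
    exact DifferentiableOn.fun_finsetProd fun i _ => by fun_prop
  · rw [siteWeight, hGw t ht]
    simp only [edist_rpow_eq hβ]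
    rw [← ENNReal.ofReal_prod_of_nonneg fun i _ => by positivity,
      ← ENNReal.ofReal_mul (by positivity), Real.finsetProd_rpow _ _ fun i _ => norm_nonneg _,
      ← Finset.prod_mul_prod_compl I, norm_mul, norm_prod,
      Real.mul_rpow (by positivity) (by positivity),
      Real.mul_rpow (by positivity) (by positivity)]
    congr 1
    ring

/-! ### The gain from leaving a crowded disk. -/

/-- A particle in a disk crowded by `k` others gains by moving to a larger disk. -/
lemma siteWeight_mul_le_lintegral {Δ : ℝ} {h : ℂ → ℝ} {Sig : Set ℂ}
    (hh : InnerProductSpace.HarmonicOnNhd h Sig) {β : ℝ} (hβ : 1 / 2 ≤ β) (hΔ : 0 ≤ Δ) {m : ℕ}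
    {p : ℂ} {ρ s : ℝ} (hρ : ball p ρ ⊆ Sig) (hs : 0 < s) (hsρ : 8 * s < ρ) (y : Fin m → ℂ)
    (I : Finset (Fin m)) (hI : ∀ i ∈ I, y i ∈ closedBall p s) {t : ℂ} (ht : t ∈ closedBall p s) :
    siteWeight Δ h Sig β y t * ENNReal.ofReal (13 * s ^ 2) ≤
      ENNReal.ofReal (Real.exp (-(β * (I.card - 49 * ((m + 1 : ℕ) * Δ * s ^ 2))))) *
        ∫⁻ z in closedBall p (8 * s), siteWeight Δ h Sig β y z ∂dA := by
  -- Centring the Gaussian at `t` makes it equal to `1` there.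
  obtain ⟨f, hf, hfw⟩ := exists_siteWeight_eq (Δ := Δ) hh (by linarith : 0 ≤ β) hρ t y I
  have hβ0 : 0 < β := by linarith
  have ht' : dist t p ≤ s := ht
  have hI' : ∀ i ∈ I, dist (y i) p ≤ s := hI
  have hsub : closedBall t (7 * s) ⊆ ball p ρ := fun z hz => by
    have := dist_triangle z t p
    simp only [mem_closedBall, mem_ball] at *
    linarith
  -- The annulus has area `13 s²`. Its points are at least `6s - 2s = 4s` from each `y i` with `i ∈
  -- I`, whereas `t` is at most `2s` away.
  have hmv := norm_rpow_mul_le_lintegral_annulus (a := 6 * s) (b := 7 * s) (q := 2 * β) hf hsub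
    (by positivity) (by linarith) (by linarith)
  have hAm : MeasurableSet (closedBall t (7 * s) \ ball t (6 * s)) :=
    measurableSet_closedBall.diff measurableSet_ball
  set k : ℝ := (I.card : ℝ) with hk
  set T : ℝ := (m + 1 : ℕ) * Δ * s ^ 2 with hT
  calc siteWeight Δ h Sig β y t * ENNReal.ofReal (13 * s ^ 2)
      ≤ ENNReal.ofReal (((2 * s) ^ I.card) ^ (2 * β)) *
          ENNReal.ofReal (‖f t‖ ^ (2 * β) * ((7 * s) ^ 2 - (6 * s) ^ 2)) := by
        rw [hfw t (mem_ball.2 (by linarith)), ← ENNReal.ofReal_mul (by positivity),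
          ← ENNReal.ofReal_mul (by positivity)]
        apply ENNReal.ofReal_le_ofReal
        have h1 : (∏ i ∈ I, ‖t - y i‖) ^ (2 * β) ≤ ((2 * s) ^ I.card) ^ (2 * β) := by
          refine Real.rpow_le_rpow (by positivity) ?_ (by linarith)
          rw [← Finset.prod_const]
          refine Finset.prod_le_prod (fun i _ => norm_nonneg _) fun i hi => ?_
          rw [← dist_eq_norm]
          linarith [dist_triangle_right t (y i) p, hI' i hi]
        have h2 : (7 * s) ^ 2 - (6 * s) ^ 2 = 13 * s ^ 2 := by ring
        rw [h2, sub_self, norm_zero]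
        simp only [ne_eq, OfNat.ofNat_ne_zero, not_false_eq_true, zero_pow, mul_zero, neg_zero,
          Real.exp_zero, one_mul]
        rw [mul_assoc]
        gcongr
    _ ≤ ENNReal.ofReal (((2 * s) ^ I.card) ^ (2 * β)) *
          ∫⁻ z in closedBall t (7 * s) \ ball t (6 * s), ENNReal.ofReal (‖f z‖ ^ (2 * β)) ∂dA := by
        gcongr
    _ = ∫⁻ z in closedBall t (7 * s) \ ball t (6 * s),
          ENNReal.ofReal (((2 * s) ^ I.card) ^ (2 * β)) *
            ENNReal.ofReal (‖f z‖ ^ (2 * β)) ∂dA := by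
        rw [lintegral_const_mul' _ _ ENNReal.ofReal_ne_top]
    _ ≤ ∫⁻ z in closedBall t (7 * s) \ ball t (6 * s),
          ENNReal.ofReal (Real.exp (-(β * (k - 49 * T)))) * siteWeight Δ h Sig β y z ∂dA := by
        refine setLIntegral_mono' hAm fun z hz => ?_
        have hz1 : dist z t ≤ 7 * s := hz.1
        have hz2 : 6 * s ≤ dist z t := not_lt.1 hz.2
        rw [hfw z (hsub hz.1), ← ENNReal.ofReal_mul (by positivity),
          ← ENNReal.ofReal_mul (by positivity)]
        apply ENNReal.ofReal_le_ofReal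
        have h1 : ((4 * s) ^ I.card) ^ (2 * β) ≤ (∏ i ∈ I, ‖z - y i‖) ^ (2 * β) := by
          refine Real.rpow_le_rpow (by positivity) ?_ (by linarith)
          rw [← Finset.prod_const]
          refine Finset.prod_le_prod (fun i _ => by positivity) fun i hi => ?_
          rw [← dist_eq_norm]
          linarith [dist_triangle z (y i) t, dist_triangle_right (y i) t p, hI' i hi]
        have h2 : Real.exp (-(β * (49 * T))) ≤
            Real.exp (-(β * ((m + 1 : ℕ) * Δ) * ‖z - t‖ ^ 2)) := by
          apply Real.exp_le_exp.2
          rw [← dist_eq_norm]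
          have : dist z t ^ 2 ≤ (7 * s) ^ 2 := by gcongr
          have h3 : β * ((m + 1 : ℕ) * Δ) * dist z t ^ 2 ≤
            β * ((m + 1 : ℕ) * Δ) * (7 * s) ^ 2 := by gcongr
          rw [hT]
          linarith
        have h3 : ((2 * s) ^ I.card) ^ (2 * β) ≤
            Real.exp (-(β * k)) * ((4 * s) ^ I.card) ^ (2 * β) := by
          have h4 : (4 * s) ^ I.card = 2 ^ I.card * (2 * s) ^ I.card := by
            rw [← mul_pow]; ring
          -- Doubling each distance gains `4 ^ β` per particle, and `e ≤ 4`.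
          have h5 : Real.exp (β * k) ≤ ((2 : ℝ) ^ I.card) ^ (2 * β) := by
            rw [Real.rpow_mul (by positivity), mul_comm β, Real.exp_mul]
            refine Real.rpow_le_rpow (by positivity) ?_ hβ0.le
            rw [Real.rpow_two, ← pow_mul, mul_comm, pow_mul, hk]
            calc Real.exp I.card = Real.exp 1 ^ I.card := by
                  rw [← Real.exp_nat_mul, mul_one]
              _ ≤ (2 ^ 2) ^ I.card := by
                  gcongr
                  linarith [Real.exp_one_lt_d9]
          rw [h4, Real.mul_rpow (by positivity) (by positivity), Real.exp_neg, ← mul_assoc,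
            inv_mul_eq_div]
          exact le_mul_of_one_le_left (by positivity) ((one_le_div (Real.exp_pos _)).2 h5)
        calc ((2 * s) ^ I.card) ^ (2 * β) * ‖f z‖ ^ (2 * β)
            ≤ (Real.exp (-(β * k)) * ((4 * s) ^ I.card) ^ (2 * β)) * ‖f z‖ ^ (2 * β) := by gcongr
          _ = Real.exp (-(β * (k - 49 * T))) * (Real.exp (-(β * (49 * T))) *
                (((4 * s) ^ I.card) ^ (2 * β) * ‖f z‖ ^ (2 * β))) := by
              rw [← mul_assoc (Real.exp _) (Real.exp _), ← Real.exp_add]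
              ring_nf
          _ ≤ _ := by gcongr
    _ ≤ ∫⁻ z in closedBall p (8 * s),
          ENNReal.ofReal (Real.exp (-(β * (k - 49 * T)))) * siteWeight Δ h Sig β y z ∂dA := by
        refine lintegral_mono_set fun z hz => ?_
        have hz1 : dist z t ≤ 7 * s := hz.1
        exact mem_closedBall.2 (by linarith [dist_triangle z t p])
    _ = _ := lintegral_const_mul' _ _ ENNReal.ofReal_ne_top

/-! ### Lipschitz estimates at the microscopic scale. -/

/-- Bernoulli's inequality at `b / a` gives the tangent-line bound for the convex power at `a`. -/
lemma rpow_sub_rpow_le {a b M q : ℝ} (hq : 1 ≤ q) (hb : 0 ≤ b) (hba : b ≤ a) (haM : a ≤ M) :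
    a ^ q - b ^ q ≤ q * M ^ (q - 1) * (a - b) := by
  rcases (hb.trans hba).eq_or_lt with h0 | ha
  · have : b = 0 := by linarith
    subst this; subst h0; simp
  · have h1 := one_add_mul_self_le_rpow_one_add (s := b / a - 1) (p := q)
      (by linarith [div_nonneg hb ha.le]) hq
    have h2 : b ^ q = a ^ q * (1 + (b / a - 1)) ^ q := by
      rw [← Real.mul_rpow ha.le (by ring_nf; positivity)]
      congr 1
      field_simp
      ring
    have h3 : a ^ q = a ^ (q - 1) * a := by
      rw [← Real.rpow_add_one ha.ne']; ring_nf
    have h4 : a ^ q * (1 + q * (b / a - 1)) ≤ b ^ q := by rw [h2]; gcongr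
    have h5 : a ^ q * (1 + q * (b / a - 1)) = a ^ q - q * a ^ (q - 1) * (a - b) := by
      rw [h3]; field_simp; ring
    have h6 : q * a ^ (q - 1) * (a - b) ≤ q * M ^ (q - 1) * (a - b) := by
      have : a ^ (q - 1) ≤ M ^ (q - 1) := Real.rpow_le_rpow ha.le haM (by linarith)
      have := sub_nonneg.2 hba
      gcongr
    linarith

/-- A Lipschitz estimate at the centre of a disk for powers of the modulus of a holomorphic
function. -/
lemma abs_norm_rpow_sub_le {f : ℂ → ℂ} {p t : ℂ} {r q A : ℝ}
    (hf : DifferentiableOn ℂ f (ball p r)) (hq : 1 ≤ q)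
    (hA : ∀ z ∈ ball p r, ‖f z‖ ^ q ≤ A) (ht : t ∈ ball p r) :
    |‖f t‖ ^ q - ‖f p‖ ^ q| ≤ 2 * q * A * (‖t - p‖ / r) := by
  have hr : 0 < r := pos_of_mem_ball ht
  have hq0 : 0 < q := by linarith
  have hA0 : 0 ≤ A := le_trans (by positivity) (hA t ht)
  set M := A ^ q⁻¹ with hM
  have hM0 : 0 ≤ M := by positivity
  have hMA : M ^ (q - 1) * M = A := by
    rcases hA0.eq_or_lt with h0 | h0
    · rw [hM, ← h0, Real.zero_rpow (inv_ne_zero hq0.ne'), mul_zero]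
    · rw [← Real.rpow_add_one (by positivity), sub_add_cancel, hM, ← Real.rpow_mul hA0,
        inv_mul_cancel₀ hq0.ne', Real.rpow_one]
  have hfM : ∀ z ∈ ball p r, ‖f z‖ ≤ M := fun z hz => by
    rw [hM, Real.le_rpow_inv_iff_of_pos (norm_nonneg _) hA0 hq0]
    exact hA z hz
  have hp : p ∈ ball p r := mem_ball_self hr
  have hmap : MapsTo f (ball p r) (closedBall (f p) (2 * M)) := fun z hz => by
    rw [mem_closedBall, dist_eq_norm]
    linarith [norm_sub_le (f z) (f p), hfM z hz, hfM p hp]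
  -- Schwarz lemma: a map from radius `r` to radius `2M` has slope at most `2M / r` from the centre.
  have hd := Complex.dist_le_div_mul_dist_of_mapsTo_ball hf hmap ht
  rw [dist_eq_norm, dist_eq_norm] at hd
  have habs : |‖f t‖ - ‖f p‖| ≤ 2 * M / r * ‖t - p‖ := (abs_norm_sub_norm_le _ _).trans hd
  have key : |‖f t‖ ^ q - ‖f p‖ ^ q| ≤ q * M ^ (q - 1) * |‖f t‖ - ‖f p‖| := by
    rcases le_total ‖f p‖ ‖f t‖ with hle | hle
    · rw [abs_of_nonneg (sub_nonneg.2 hle), abs_of_nonneg (sub_nonneg.2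
        (Real.rpow_le_rpow (norm_nonneg _) hle hq0.le))]
      exact rpow_sub_rpow_le hq (norm_nonneg _) hle (hfM t ht)
    · rw [abs_sub_comm, abs_sub_comm ‖f t‖, abs_of_nonneg (sub_nonneg.2 hle), abs_of_nonneg
        (sub_nonneg.2 (Real.rpow_le_rpow (norm_nonneg _) hle hq0.le))]
      exact rpow_sub_rpow_le hq (norm_nonneg _) hle (hfM p hp)
  calc |‖f t‖ ^ q - ‖f p‖ ^ q| ≤ q * M ^ (q - 1) * (2 * M / r * ‖t - p‖) := by
        refine key.trans ?_
        gcongr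
    _ = 2 * q * (M ^ (q - 1) * M) * (‖t - p‖ / r) := by ring
    _ = _ := by rw [hMA]

/-- The site weight at the centre of a disk is controlled by its integral, and so is its
oscillation near the centre. -/
lemma siteWeight_lipschitz {Δ : ℝ} {h : ℂ → ℝ} {Sig : Set ℂ}
    (hh : InnerProductSpace.HarmonicOnNhd h Sig) {β : ℝ} (hβ : 1 / 2 ≤ β) (hΔ : 0 ≤ Δ) {m : ℕ}
    {p : ℂ} {ρ r : ℝ} (hρ : ball p ρ ⊆ Sig) (hr : 0 < r) (hrρ : 2 * r < ρ)
    (hnr : (m + 1 : ℕ) * Δ * r ^ 2 ≤ 1) (y : Fin m → ℂ) {t : ℂ} (ht : t ∈ ball p r) :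
    siteWeight Δ h Sig β y p ≤ ENNReal.ofReal (Real.exp (4 * β) / r ^ 2) *
        ∫⁻ z in closedBall p (2 * r), siteWeight Δ h Sig β y z ∂dA ∧
    siteWeight Δ h Sig β y t ≤ siteWeight Δ h Sig β y p +
      ENNReal.ofReal (5 * β * Real.exp (4 * β) / r ^ 3 * ‖t - p‖) *
        ∫⁻ z in closedBall p (2 * r), siteWeight Δ h Sig β y z ∂dA ∧
    siteWeight Δ h Sig β y p ≤ siteWeight Δ h Sig β y t +
      ENNReal.ofReal (5 * β * Real.exp (4 * β) / r ^ 3 * ‖t - p‖) *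
        ∫⁻ z in closedBall p (2 * r), siteWeight Δ h Sig β y z ∂dA := by
  have hβ0 : 0 < β := by linarith
  obtain ⟨f, hf, hfw⟩ := exists_siteWeight_eq (Δ := Δ) hh hβ0.le hρ p y ∅
  simp only [Finset.prod_empty, Real.one_rpow, one_mul] at hfw
  set S := ∫⁻ z in closedBall p (2 * r), siteWeight Δ h Sig β y z ∂dA
  set J := ∫⁻ z in closedBall p (2 * r), ENNReal.ofReal (‖f z‖ ^ (2 * β)) ∂dA with hJ
  have hsub : closedBall p (2 * r) ⊆ ball p ρ := closedBall_subset_ball hrρ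
  -- On this disk the Gaussian exponent is at most `β n Δ (2r)² ≤ 4β`.
  have hJS : J ≤ ENNReal.ofReal (Real.exp (4 * β)) * S := by
    rw [hJ, ← lintegral_const_mul' _ _ ENNReal.ofReal_ne_top]
    refine setLIntegral_mono' measurableSet_closedBall fun z hz => ?_
    have hz' : dist z p ≤ 2 * r := hz
    rw [hfw z (hsub hz), ← ENNReal.ofReal_mul (by positivity), ← mul_assoc, ← Real.exp_add]
    refine ENNReal.ofReal_le_ofReal (le_mul_of_one_le_left (by positivity) ?_)
    rw [Real.one_le_exp_iff, ← dist_eq_norm]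
    have h1 : dist z p ^ 2 ≤ (2 * r) ^ 2 := by gcongr
    have h2 : β * ((m + 1 : ℕ) * Δ) * dist z p ^ 2 ≤ β * ((m + 1 : ℕ) * Δ) * (2 * r) ^ 2 := by
      gcongr
    have h3 : β * ((m + 1 : ℕ) * Δ * r ^ 2) ≤ β * 1 := by gcongr
    linarith
  have hJfin : J ≠ ⊤ := by
    obtain ⟨M, hM⟩ := (isCompact_closedBall p (2 * r)).exists_bound_of_continuousOn
      (hf.continuousOn.mono hsub)
    refine ne_top_of_le_ne_top ?_ (setLIntegral_mono' (g := fun _ => ENNReal.ofReal (M ^ (2 * β)))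
      measurableSet_closedBall fun z hz => ENNReal.ofReal_le_ofReal
        (Real.rpow_le_rpow (norm_nonneg _) (hM z hz) (by linarith)))
    rw [setLIntegral_const, dA_closedBall p (by positivity)]
    exact ENNReal.mul_ne_top ENNReal.ofReal_ne_top ENNReal.ofReal_ne_top
  set A : ℝ := J.toReal / r ^ 2 with hAdef
  have hA0 : 0 ≤ A := by positivity
  -- Sub-mean value inequality on the disk of radius `r` about `z`, which stays in the disk of
  -- radius `2r` about `p`.
  have hA : ∀ z ∈ ball p r, ‖f z‖ ^ (2 * β) ≤ A := fun z hz => by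
    have hz' : dist z p < r := hz
    have hsub' : closedBall z r ⊆ closedBall p (2 * r) :=
      closedBall_subset_closedBall' (by linarith)
    have := norm_rpow_mul_le_lintegral_annulus (a := 0) (b := r) (q := 2 * β) hf
      (hsub'.trans hsub) le_rfl hr.le (by linarith)
    rw [ball_zero, sdiff_empty] at this
    have h2 := this.trans (lintegral_mono_set hsub')
    rw [hAdef, le_div_iff₀ (by positivity)]
    have h3 := (ENNReal.ofReal_le_iff_le_toReal hJfin).1 h2
    simpa using h3
  have hAS : ∀ x : ℝ, 0 ≤ x → ENNReal.ofReal (x * A) ≤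
      ENNReal.ofReal (x * (Real.exp (4 * β) / r ^ 2)) * S := fun x hx => by
    have h1 : ENNReal.ofReal (x * A) = ENNReal.ofReal (x / r ^ 2) * J := by
      rw [← ENNReal.ofReal_toReal hJfin, ← ENNReal.ofReal_mul (by positivity), hAdef]
      congr 1
      ring
    have h2 : x * (Real.exp (4 * β) / r ^ 2) = x / r ^ 2 * Real.exp (4 * β) := by ring
    rw [h1, h2, ENNReal.ofReal_mul (by positivity), mul_assoc]
    gcongr
  have hp : p ∈ ball p r := mem_ball_self hr
  have hsub2 : ball p r ⊆ ball p ρ := ball_subset_ball (by linarith)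
  have hwp : siteWeight Δ h Sig β y p = ENNReal.ofReal (‖f p‖ ^ (2 * β)) := by
    rw [hfw p (hsub2 hp)]; simp
  have ht' : ‖t - p‖ < r := by rw [← dist_eq_norm]; exact ht
  set x : ℝ := β * ((m + 1 : ℕ) * Δ) * ‖t - p‖ ^ 2 with hx
  have hx0 : 0 ≤ x := by positivity
  have hxle : x ≤ β * (‖t - p‖ / r) := by
    have h1 : x = β * ((m + 1 : ℕ) * Δ * r ^ 2) * (‖t - p‖ / r) * (‖t - p‖ / r) := by
      rw [hx]; field_simp
    have h2 : ‖t - p‖ / r ≤ 1 := (div_le_one hr).2 ht'.le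
    rw [h1]
    calc β * ((m + 1 : ℕ) * Δ * r ^ 2) * (‖t - p‖ / r) * (‖t - p‖ / r)
        ≤ β * 1 * (‖t - p‖ / r) * 1 := by gcongr
      _ = _ := by ring
  -- The slope here is `2q = 4β` in units of `A / r`; the Gaussian contributes another `β` through
  -- `hxA`, hence the constant `5β`.
  have hlip := abs_norm_rpow_sub_le (q := 2 * β) (hf.mono hsub2) (by linarith) hA ht
  have hlip' := abs_le.1 hlip
  have he1 : Real.exp (-x) ≤ 1 := Real.exp_le_one_iff.2 (by linarith)
  have he2 : 1 - x ≤ Real.exp (-x) := Real.one_sub_le_exp_neg x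
  have hft := hA t ht
  have hft0 : 0 ≤ ‖f t‖ ^ (2 * β) := by positivity
  have hconst : 5 * β * Real.exp (4 * β) / r ^ 3 * ‖t - p‖ =
      5 * β * (‖t - p‖ / r) * (Real.exp (4 * β) / r ^ 2) := by field_simp
  have hxA : x * ‖f t‖ ^ (2 * β) ≤ β * (‖t - p‖ / r) * A := by gcongr
  refine ⟨?_, ?_, ?_⟩
  · have := hAS 1 zero_le_one
    rw [one_mul, one_mul] at this
    rw [hwp]
    exact (ENNReal.ofReal_le_ofReal (hA p hp)).trans this
  all_goals
    rw [hconst]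
    refine le_trans ?_ (add_le_add_right (hAS _ (by positivity)) _)
    rw [hwp, hfw t (hsub2 ht), ← ENNReal.ofReal_add (by positivity) (by positivity)]
    apply ENNReal.ofReal_le_ofReal
  · nlinarith [mul_le_mul_of_nonneg_right he1 hft0,
      mul_nonneg (mul_nonneg hβ0.le (div_nonneg (norm_nonneg (t - p)) hr.le)) hA0]
  · nlinarith [mul_le_mul_of_nonneg_right he2 hft0]

/-! ### Measurability and integration over one particle. -/

lemma measurable_weight {Δ : ℝ} {h : ℂ → ℝ} {Sig : Set ℂ} (hSig : IsCompact Sig)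
    (hh : InnerProductSpace.HarmonicOnNhd h Sig) (β : ℝ) (n : ℕ) :
    Measurable (weight Δ h Sig β n) := by
  classical
  have hc : ContinuousOn h Sig := fun x hx =>
    (hh x hx).1.continuousAt.continuousWithinAt
  have h1 : ContinuousOn
      (fun t => ENNReal.ofReal (Real.exp (-(β * n * (Δ * ‖t‖ ^ 2 + h t))))) Sig :=
    ENNReal.continuous_ofReal.comp_continuousOn (by fun_prop)
  convert h1.measurable_piecewise (g := fun _ => 0) continuousOn_const hSig.measurableSet using 1
  ext t
  by_cases ht : t ∈ Sig <;> simp [weight, ht]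

lemma measurable_siteWeight {Δ : ℝ} {h : ℂ → ℝ} {Sig : Set ℂ} (hSig : IsCompact Sig)
    (hh : InnerProductSpace.HarmonicOnNhd h Sig) (β : ℝ) (m : ℕ) :
    Measurable fun x : ℂ × (Fin m → ℂ) => siteWeight Δ h Sig β x.2 x.1 := by
  have := measurable_weight (Δ := Δ) hSig hh β (m + 1)
  unfold siteWeight
  fun_prop

lemma measurable_siteWeight_apply {Δ : ℝ} {h : ℂ → ℝ} {Sig : Set ℂ} (hSig : IsCompact Sig)
    (hh : InnerProductSpace.HarmonicOnNhd h Sig) (β : ℝ) {m : ℕ} (y : Fin m → ℂ) :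
    Measurable (siteWeight Δ h Sig β y) :=
  (measurable_siteWeight hSig hh β m).comp (measurable_id.prodMk measurable_const)

lemma measurable_restWeight {Δ : ℝ} {h : ℂ → ℝ} {Sig : Set ℂ} (hSig : IsCompact Sig)
    (hh : InnerProductSpace.HarmonicOnNhd h Sig) (β : ℝ) (m : ℕ) :
    Measurable fun y : Fin m → ℂ => restWeight Δ h Sig β y := by
  have := measurable_weight (Δ := Δ) hSig hh β (m + 1)
  unfold restWeight
  fun_prop

lemma measurable_boltzmann {Δ : ℝ} {h : ℂ → ℝ} {Sig : Set ℂ} (hSig : IsCompact Sig)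
    (hh : InnerProductSpace.HarmonicOnNhd h Sig) {β : ℝ} (hβ : 0 < β) {n : ℕ} (hn : n ≠ 0) :
    Measurable (boltzmann (potential Δ h Sig) β n) := by
  have := measurable_weight (Δ := Δ) hSig hh β n
  rw [funext (boltzmann_eq (Δ := Δ) (h := h) (Sig := Sig) hβ hn)]
  fun_prop

instance (m : ℕ) : SigmaFinite (dAn m) := by unfold dAn; infer_instance

/-- Integration against the Boltzmann factor, with the particle `k` singled out. -/
lemma lintegral_mul_boltzmann {Δ : ℝ} {h : ℂ → ℝ} {Sig : Set ℂ} (hSig : IsCompact Sig)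
    (hh : InnerProductSpace.HarmonicOnNhd h Sig) {β : ℝ} (hβ : 0 < β) {m : ℕ} (k : Fin (m + 1))
    {φ : ℂ × (Fin m → ℂ) → ℝ≥0∞} (hφ : Measurable φ) :
    ∫⁻ z, φ (z k, fun j => z (k.succAbove j)) * boltzmann (potential Δ h Sig) β (m + 1) z
        ∂(dAn (m + 1)) =
      ∫⁻ y, (∫⁻ t, φ (t, y) * siteWeight Δ h Sig β y t ∂dA) * restWeight Δ h Sig β y
        ∂(dAn m) := by
  have hsw := measurable_siteWeight (Δ := Δ) hSig hh β m
  have hrw := measurable_restWeight (Δ := Δ) hSig hh β m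
  have hmp := measurePreserving_piFinSuccAbove (fun _ : Fin (m + 1) => dA) k
  have h1 : ∀ z : Fin (m + 1) → ℂ,
      φ (z k, fun j => z (k.succAbove j)) * boltzmann (potential Δ h Sig) β (m + 1) z =
      (fun x : ℂ × (Fin m → ℂ) => φ x * (siteWeight Δ h Sig β x.2 x.1 *
        restWeight Δ h Sig β x.2)) (MeasurableEquiv.piFinSuccAbove (fun _ => ℂ) k z) := by
    intro z
    have hz : z = Fin.insertNth (α := fun _ => ℂ) k (z k) (fun j => z (k.succAbove j)) :=
      (Fin.insertNth_self_removeNth k z).symm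
    simp only [← boltzmann_insertNth hβ k]
    conv_lhs => rw [hz]
    simp only [Fin.insertNth_apply_same, Fin.insertNth_apply_succAbove]
    rfl
  simp only [h1]
  rw [dAn]
  refine (hmp.lintegral_comp (f := fun x : ℂ × (Fin m → ℂ) => φ x *
    (siteWeight Δ h Sig β x.2 x.1 * restWeight Δ h Sig β x.2)) (by fun_prop)).trans ?_
  rw [lintegral_prod_symm _ (Measurable.aemeasurable (by fun_prop))]
  refine lintegral_congr fun y => ?_
  have hy := measurable_siteWeight_apply (Δ := Δ) hSig hh β y
  simp only [← mul_assoc]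
  rw [lintegral_mul_const _ (by fun_prop)]

/-- The unnormalized density of a single particle. -/
noncomputable def siteDensity (Δ : ℝ) (h : ℂ → ℝ) (Sig : Set ℂ) (β : ℝ) (m : ℕ) (t : ℂ) :
    ℝ≥0∞ :=
  ∫⁻ y, siteWeight Δ h Sig β y t * restWeight Δ h Sig β y ∂(dAn m)

lemma measurable_siteDensity {Δ : ℝ} {h : ℂ → ℝ} {Sig : Set ℂ} (hSig : IsCompact Sig)
    (hh : InnerProductSpace.HarmonicOnNhd h Sig) (β : ℝ) (m : ℕ) :
    Measurable (siteDensity Δ h Sig β m) := by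
  have hsw := measurable_siteWeight (Δ := Δ) hSig hh β m
  have hrw := measurable_restWeight (Δ := Δ) hSig hh β m
  exact Measurable.lintegral_prod_right' (f := fun x : ℂ × (Fin m → ℂ) =>
    siteWeight Δ h Sig β x.2 x.1 * restWeight Δ h Sig β x.2) (by fun_prop)

lemma setLIntegral_siteDensity {Δ : ℝ} {h : ℂ → ℝ} {Sig : Set ℂ} (hSig : IsCompact Sig)
    (hh : InnerProductSpace.HarmonicOnNhd h Sig) (β : ℝ) (m : ℕ) (s : Set ℂ) :
    ∫⁻ t in s, siteDensity Δ h Sig β m t ∂dA =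
      ∫⁻ y, (∫⁻ t in s, siteWeight Δ h Sig β y t ∂dA) * restWeight Δ h Sig β y ∂(dAn m) := by
  have hsw := measurable_siteWeight (Δ := Δ) hSig hh β m
  have hrw := measurable_restWeight (Δ := Δ) hSig hh β m
  simp only [siteDensity]
  rw [lintegral_lintegral_swap (Measurable.aemeasurable (by fun_prop))]
  refine lintegral_congr fun y => ?_
  rw [lintegral_mul_const _ (measurable_siteWeight_apply hSig hh β y)]

lemma lintegral_siteDensity {Δ : ℝ} {h : ℂ → ℝ} {Sig : Set ℂ} (hSig : IsCompact Sig)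
    (hh : InnerProductSpace.HarmonicOnNhd h Sig) {β : ℝ} (hβ : 0 < β) (m : ℕ) :
    ∫⁻ t, siteDensity Δ h Sig β m t ∂dA =
      partitionFunction (potential Δ h Sig) β (m + 1) := by
  rw [← setLIntegral_univ, setLIntegral_siteDensity hSig hh]
  have := lintegral_mul_boltzmann (Δ := Δ) hSig hh hβ (0 : Fin (m + 1)) (φ := fun _ => 1)
    measurable_const
  simp only [one_mul] at this
  rw [partitionFunction, this]
  simp only [Measure.restrict_univ]

/-! ### Expected particle counts in disks. -/

lemma particleCount_eq_add {m : ℕ} (p : ℂ) (s : ℝ) (z : Fin (m + 1) → ℂ) (k : Fin (m + 1)) :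
    (particleCount p s z : ℝ≥0∞) = (closedBall p s).indicator (fun _ => 1) (z k) +
      particleCount p s fun j => z (k.succAbove j) := by
  classical
  unfold particleCount
  simp only [Finset.card_filter]
  rw [Fin.sum_univ_succAbove _ k]
  by_cases hk : z k ∈ closedBall p s <;> simp [hk]

lemma particleCount_eq_sum {n : ℕ} (p : ℂ) (s : ℝ) (z : Fin n → ℂ) :
    (particleCount p s z : ℝ≥0∞) = ∑ k, (closedBall p s).indicator (fun _ => 1) (z k) := by
  classical
  unfold particleCount
  rw [Finset.card_filter]
  push_cast
  rfl

lemma measurable_particleCount {n : ℕ} (p : ℂ) (s : ℝ) :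
    Measurable fun z : Fin n → ℂ => (particleCount p s z : ℝ≥0∞) := by
  simp only [particleCount_eq_sum]
  refine Finset.measurable_fun_sum _ fun k _ => ?_
  exact (measurable_const.indicator measurableSet_closedBall).comp (measurable_pi_apply k)

/-- The expected number of particles in a disk. -/
lemma lintegral_particleCount {Δ : ℝ} {h : ℂ → ℝ} {Sig : Set ℂ} (hSig : IsCompact Sig)
    (hh : InnerProductSpace.HarmonicOnNhd h Sig) {β : ℝ} (hβ : 0 < β) (m : ℕ) (p : ℂ) (ε : ℝ) :
    ∫⁻ z, (particleCount p ε z : ℝ≥0∞) ∂(gibbs (potential Δ h Sig) β (m + 1)) =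
      (partitionFunction (potential Δ h Sig) β (m + 1))⁻¹ *
        ((m + 1 : ℕ) * ∫⁻ t in closedBall p ε, siteDensity Δ h Sig β m t ∂dA) := by
  have hb := measurable_boltzmann (Δ := Δ) hSig hh hβ m.succ_ne_zero
  have hind : Measurable ((closedBall p ε).indicator fun _ : ℂ => (1 : ℝ≥0∞)) :=
    measurable_const.indicator measurableSet_closedBall
  rw [gibbs, lintegral_smul_measure, smul_eq_mul,
    lintegral_withDensity_eq_lintegral_mul _ hb (measurable_particleCount p ε)]
  congr 1
  simp only [Pi.mul_apply, particleCount_eq_sum, mul_comm (boltzmann _ _ _ _), Finset.sum_mul]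
  rw [lintegral_finsetSum]
  swap
  · exact fun k _ => (hind.comp (measurable_pi_apply k)).mul hb
  have : ∀ k : Fin (m + 1), ∫⁻ z, (closedBall p ε).indicator (fun _ => (1 : ℝ≥0∞)) (z k) *
      boltzmann (potential Δ h Sig) β (m + 1) z ∂(dAn (m + 1)) =
      ∫⁻ t in closedBall p ε, siteDensity Δ h Sig β m t ∂dA := fun k => by
    refine (lintegral_mul_boltzmann hSig hh hβ k (hind.comp measurable_fst)).trans ?_
    rw [setLIntegral_siteDensity hSig hh]
    refine lintegral_congr fun y => ?_
    congr 1
    rw [← lintegral_indicator measurableSet_closedBall]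
    refine lintegral_congr fun t => ?_
    by_cases ht : t ∈ closedBall p ε <;> simp [ht]
  simp [this]

/-- As soon as one particle of the disk sees fewer than `K` others there, the disk holds at most `K
+ 1` particles in all, and only particles of the disk contribute to the sum. -/
lemma sum_indicator_le {m : ℕ} (p : ℂ) (s : ℝ) {K : ℝ} (hK : 0 ≤ K) (z : Fin (m + 1) → ℂ) :
    ∑ k, {x : ℂ × (Fin m → ℂ) | x.1 ∈ closedBall p s ∧
        (particleCount p s x.2 : ℝ≥0∞) < ENNReal.ofReal K}.indicator (fun _ => (1 : ℝ≥0∞))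
          (z k, fun j => z (k.succAbove j)) ≤ ENNReal.ofReal (K + 1) := by
  by_cases hex : ∃ k, z k ∈ closedBall p s ∧
      (particleCount p s (fun j => z (k.succAbove j)) : ℝ≥0∞) < ENNReal.ofReal K
  · obtain ⟨k, hk, hkK⟩ := hex
    have h1 := particleCount_eq_add p s z k
    rw [indicator_of_mem hk] at h1
    have h2 : (particleCount p s z : ℝ≥0∞) ≤ ENNReal.ofReal (K + 1) := by
      rw [h1, ENNReal.ofReal_add hK zero_le_one, ENNReal.ofReal_one, add_comm]
      gcongr
    refine le_trans ?_ h2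
    rw [particleCount_eq_sum]
    refine Finset.sum_le_sum fun i _ => ?_
    by_cases hi : z i ∈ closedBall p s
    · rw [indicator_of_mem hi]
      exact indicator_le_self' (by simp) _
    · rw [indicator_of_notMem (fun h => hi h.1)]
      exact zero_le
  · refine (Finset.sum_eq_zero fun k _ => ?_).trans_le zero_le
    refine indicator_of_notMem ?_ _
    exact fun h => hex ⟨k, h⟩

/-- The expected number of particles in a disk, compared with that in a larger disk. -/
lemma count_le_add {Δ : ℝ} {h : ℂ → ℝ} {Sig : Set ℂ} (hSig : IsCompact Sig)
    (hh : InnerProductSpace.HarmonicOnNhd h Sig) {β : ℝ} (hβ : 1 / 2 ≤ β) (hΔ : 0 ≤ Δ) (m : ℕ)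
    {p : ℂ} {ρ s K : ℝ} (hρ : ball p ρ ⊆ Sig) (hs : 0 < s) (hsρ : 8 * s < ρ) (hK : 0 ≤ K) :
    (m + 1 : ℕ) * ∫⁻ t in closedBall p s, siteDensity Δ h Sig β m t ∂dA ≤
      ENNReal.ofReal (K + 1) * partitionFunction (potential Δ h Sig) β (m + 1) +
      ENNReal.ofReal (Real.exp (-(β * (K - 49 * ((m + 1 : ℕ) * Δ * s ^ 2)))) / 13) *
        ((m + 1 : ℕ) * ∫⁻ t in closedBall p (8 * s), siteDensity Δ h Sig β m t ∂dA) := by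
  classical
  have hβ0 : 0 < β := by linarith
  have hsw := measurable_siteWeight (Δ := Δ) hSig hh β m
  have hrw := measurable_restWeight (Δ := Δ) hSig hh β m
  have hb := measurable_boltzmann (Δ := Δ) hSig hh hβ0 m.succ_ne_zero
  set E := Real.exp (-(β * (K - 49 * ((m + 1 : ℕ) * Δ * s ^ 2)))) with hE
  -- Sparse configurations: the distinguished particle is in the disk with fewer than `K` others.
  -- They are counted by `sum_indicator_le`; the crowded ones are moved out.
  set P : Set (ℂ × (Fin m → ℂ)) := {x | x.1 ∈ closedBall p s ∧
    (particleCount p s x.2 : ℝ≥0∞) < ENNReal.ofReal K} with hP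
  have hPm : MeasurableSet P := (measurableSet_closedBall.preimage measurable_fst).inter
    (measurableSet_lt ((measurable_particleCount p s).comp measurable_snd) measurable_const)
  have hφ : Measurable (P.indicator fun _ => (1 : ℝ≥0∞)) := measurable_const.indicator hPm
  have hsparse : (m + 1 : ℕ) * ∫⁻ y, (∫⁻ t, P.indicator (fun _ => (1 : ℝ≥0∞)) (t, y) *
      siteWeight Δ h Sig β y t ∂dA) * restWeight Δ h Sig β y ∂(dAn m) ≤
      ENNReal.ofReal (K + 1) * partitionFunction (potential Δ h Sig) β (m + 1) := by
    calc _ = ∑ k : Fin (m + 1), ∫⁻ z, P.indicator (fun _ => (1 : ℝ≥0∞))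
          (z k, fun j => z (k.succAbove j)) * boltzmann (potential Δ h Sig) β (m + 1) z
            ∂(dAn (m + 1)) := by
          simp [lintegral_mul_boltzmann hSig hh hβ0 _ hφ]
      _ = ∫⁻ z, (∑ k : Fin (m + 1), P.indicator (fun _ => (1 : ℝ≥0∞))
          (z k, fun j => z (k.succAbove j))) * boltzmann (potential Δ h Sig) β (m + 1) z
            ∂(dAn (m + 1)) := by
          simp only [Finset.sum_mul]
          rw [lintegral_finsetSum]
          exact fun k _ => (hφ.comp (by fun_prop)).mul hb
      _ ≤ ∫⁻ z, ENNReal.ofReal (K + 1) * boltzmann (potential Δ h Sig) β (m + 1) z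
            ∂(dAn (m + 1)) :=
          lintegral_mono fun z => mul_le_mul_left (sum_indicator_le p s hK z) _
      _ = _ := lintegral_const_mul' _ _ ENNReal.ofReal_ne_top
  -- For each `y` one of the two terms suffices. In the crowded case, the disk area `s²` against the
  -- annulus area `13 s²` leaves `E / 13`.
  have hpt : ∀ y : Fin m → ℂ, ∫⁻ t in closedBall p s, siteWeight Δ h Sig β y t ∂dA ≤
      ∫⁻ t, P.indicator (fun _ => (1 : ℝ≥0∞)) (t, y) * siteWeight Δ h Sig β y t ∂dA +
      ENNReal.ofReal (E / 13) *
        ∫⁻ t in closedBall p (8 * s), siteWeight Δ h Sig β y t ∂dA := fun y => by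
    by_cases hy : (particleCount p s y : ℝ≥0∞) < ENNReal.ofReal K
    · refine le_add_right ?_
      rw [← lintegral_indicator measurableSet_closedBall]
      refine lintegral_mono fun t => ?_
      by_cases ht : t ∈ closedBall p s
      · rw [indicator_of_mem ht, indicator_of_mem (show (t, y) ∈ P from ⟨ht, hy⟩), one_mul]
      · rw [indicator_of_notMem ht]; exact zero_le
    · refine le_add_left ?_
      have hc : K ≤ particleCount p s y := by
        have := not_lt.1 hy
        rwa [← ENNReal.ofReal_natCast, ENNReal.ofReal_le_ofReal_iff (by positivity)] at this
      set S := ∫⁻ t in closedBall p (8 * s), siteWeight Δ h Sig β y t ∂dA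
      calc ∫⁻ t in closedBall p s, siteWeight Δ h Sig β y t ∂dA
          ≤ ∫⁻ t in closedBall p s, ENNReal.ofReal (E / (13 * s ^ 2)) * S ∂dA := by
            refine setLIntegral_mono' measurableSet_closedBall fun t ht => ?_
            have := siteWeight_mul_le_lintegral (Δ := Δ) hh hβ hΔ hρ hs hsρ y
              (Finset.univ.filter fun j => y j ∈ closedBall p s) (by simp) ht
            rw [ENNReal.ofReal_div_of_pos (by positivity), ENNReal.mul_comm_div,
              ← mul_div_assoc, ENNReal.le_div_iff_mul_le
              (Or.inl (by simp only [ne_eq, ENNReal.ofReal_eq_zero, not_le]; positivity))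
              (Or.inl ENNReal.ofReal_ne_top)]
            refine this.trans ?_
            refine mul_le_mul_left (ENNReal.ofReal_le_ofReal (Real.exp_le_exp.2 ?_)) _
            gcongr
            rw [particleCount] at hc
            convert hc
        _ = _ := by
            rw [setLIntegral_const, dA_closedBall p hs.le, mul_right_comm,
              ← ENNReal.ofReal_mul (by positivity)]
            congr 2
            field_simp
  calc _ = (m + 1 : ℕ) * ∫⁻ y, (∫⁻ t in closedBall p s, siteWeight Δ h Sig β y t ∂dA) *
          restWeight Δ h Sig β y ∂(dAn m) := by rw [setLIntegral_siteDensity hSig hh]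
    _ ≤ (m + 1 : ℕ) * ∫⁻ y, ((∫⁻ t, P.indicator (fun _ => (1 : ℝ≥0∞)) (t, y) *
          siteWeight Δ h Sig β y t ∂dA) * restWeight Δ h Sig β y +
          ENNReal.ofReal (E / 13) * ((∫⁻ t in closedBall p (8 * s), siteWeight Δ h Sig β y t ∂dA) *
            restWeight Δ h Sig β y)) ∂(dAn m) := by
        gcongr with y
        rw [← mul_assoc, ← add_mul]
        gcongr
        exact hpt y
    _ = (m + 1 : ℕ) * ∫⁻ y, (∫⁻ t, P.indicator (fun _ => (1 : ℝ≥0∞)) (t, y) *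
          siteWeight Δ h Sig β y t ∂dA) * restWeight Δ h Sig β y ∂(dAn m) +
          ENNReal.ofReal (E / 13) * ((m + 1 : ℕ) *
            ∫⁻ t in closedBall p (8 * s), siteDensity Δ h Sig β m t ∂dA) := by
        rw [lintegral_add_left, lintegral_const_mul' _ _ ENNReal.ofReal_ne_top, mul_add,
          ← setLIntegral_siteDensity hSig hh]
        · ring
        · refine Measurable.mul ?_ hrw
          exact Measurable.lintegral_prod_left' (f := fun x : ℂ × (Fin m → ℂ) =>
            P.indicator (fun _ => (1 : ℝ≥0∞)) x * siteWeight Δ h Sig β x.2 x.1) (hφ.mul hsw)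
    _ ≤ _ := by gcongr

/-- The expected number of particles in a disk is at most a multiple of its area in the
microscopic scale. -/
lemma count_le {Δ Δ₀ η T₀ : ℝ} {h : ℂ → ℝ} {Sig : Set ℂ} (hSig : IsCompact Sig)
    (hh : InnerProductSpace.HarmonicOnNhd h Sig) {β : ℝ} (hβ : 1 / 2 ≤ β) (hΔ₀ : 0 < Δ₀)
    (hΔ : Δ₀ ≤ Δ) (hη : 0 < η) (hT₀ : 0 < T₀) (m : ℕ) {p : ℂ} (hp : ball p η ⊆ Sig) (j : ℕ) :
    ∀ s : ℝ, 0 < s → T₀ ≤ (m + 1 : ℕ) * Δ * s ^ 2 → η ≤ 8 ^ (j + 1) * s →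
    (m + 1 : ℕ) * ∫⁻ t in closedBall p s, siteDensity Δ h Sig β m t ∂dA ≤
      ENNReal.ofReal ((98 + 14 / T₀ + 64 / (Δ₀ * η ^ 2)) * ((m + 1 : ℕ) * Δ * s ^ 2)) *
        partitionFunction (potential Δ h Sig) β (m + 1) := by
  have hβ0 : 0 < β := by linarith
  have hΔpos : 0 < Δ := hΔ₀.trans_le hΔ
  -- The first two terms are twice what is needed to absorb `49 T + 7` when `T ≥ T₀`; the third
  -- serves the base case.
  set B := 98 + 14 / T₀ + 64 / (Δ₀ * η ^ 2) with hB
  have hB0 : 0 < B := by positivity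
  -- Once `8s ≥ η`, one has `64 Δ s² ≥ Δ₀ η²`, so even the total number of particles obeys the
  -- bound.
  have base : ∀ s : ℝ, 0 < s → η ≤ 8 * s →
      (m + 1 : ℕ) * ∫⁻ t in closedBall p s, siteDensity Δ h Sig β m t ∂dA ≤
      ENNReal.ofReal (B * ((m + 1 : ℕ) * Δ * s ^ 2)) *
        partitionFunction (potential Δ h Sig) β (m + 1) := fun s hs hηs => by
    refine mul_le_mul' ?_ ?_
    · rw [← ENNReal.ofReal_natCast]
      apply ENNReal.ofReal_le_ofReal
      have h1 : 64 / (Δ₀ * η ^ 2) ≤ B := by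
        have : 0 < 14 / T₀ := by positivity
        linarith
      have h2 : η ^ 2 ≤ (8 * s) ^ 2 := by gcongr
      have h3 : 1 ≤ 64 / (Δ₀ * η ^ 2) * (Δ * s ^ 2) := by
        rw [div_mul_eq_mul_div, one_le_div (by positivity)]
        calc Δ₀ * η ^ 2 ≤ Δ * (8 * s) ^ 2 := by gcongr
          _ = _ := by ring
      calc ((m + 1 : ℕ) : ℝ) = (m + 1 : ℕ) * 1 := by ring
        _ ≤ (m + 1 : ℕ) * (B * (Δ * s ^ 2)) := by
          gcongr
          exact h3.trans (by gcongr)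
        _ = _ := by ring
    · rw [← lintegral_siteDensity hSig hh hβ0]
      exact setLIntegral_le_lintegral _ _
  induction j with
  | zero => exact fun s hs _ hηs => base s hs (by simpa using hηs)
  | succ j ih =>
    intro s hs hT hηs
    rcases le_or_gt η (8 * s) with h8 | h8
    · exact base s hs h8
    set T := (m + 1 : ℕ) * Δ * s ^ 2 with hTdef
    have hT0 : 0 < T := hT₀.trans_le hT
    have hT64 : (m + 1 : ℕ) * Δ * (8 * s) ^ 2 = 64 * T := by rw [hTdef]; ring
    -- With this `K` the exponential is `exp (-6β) ≤ exp (-3) ≤ 1/10`. The area of the larger disk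
    -- brings a factor `64`, and `64 / 130 < 1/2` closes the induction.
    have h1 := count_le_add (Δ := Δ) hSig hh hβ hΔpos.le m (K := 49 * T + 6) hp hs h8
      (by positivity)
    have h2 := ih (8 * s) (by positivity) (by rw [hT64]; linarith)
      (by rw [← mul_assoc, ← pow_succ]; exact hηs)
    rw [hT64] at h2
    rw [← hTdef] at h1
    clear_value T
    have hE : Real.exp (-(β * (49 * T + 6 - 49 * T))) ≤ 1 / 10 := by
      have h3 : Real.exp (-(β * (49 * T + 6 - 49 * T))) ≤ Real.exp (-3) := by
        apply Real.exp_le_exp.2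
        linarith
      have h4 : (10 : ℝ) ≤ Real.exp 3 := by
        have h5 : Real.exp 3 = Real.exp 1 ^ 3 := by rw [← Real.exp_nat_mul]; norm_num
        have h6 : (2.7 : ℝ) ^ 3 ≤ Real.exp 1 ^ 3 := by
          gcongr
          linarith [Real.exp_one_gt_d9]
        rw [h5]
        linarith
      rw [Real.exp_neg 3] at h3
      refine h3.trans ?_
      rw [one_div]
      exact inv_anti₀ (by norm_num) h4
    refine h1.trans ((add_le_add_right (mul_le_mul_right h2 _) _).trans ?_)
    rw [← mul_assoc, ← add_mul, ← ENNReal.ofReal_mul (by positivity),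
      ← ENNReal.ofReal_add (by positivity) (by positivity)]
    gcongr
    have h5 : Real.exp (-(β * (49 * T + 6 - 49 * T))) / 13 * (B * (64 * T)) ≤
        (1 / 10) / 13 * (B * (64 * T)) := by gcongr
    have h6 : 14 ≤ 14 / T₀ * T := by
      rw [div_mul_eq_mul_div, le_div_iff₀ hT₀]
      linarith
    have h7 : 0 < 64 / (Δ₀ * η ^ 2) * T := by positivity
    have h8 : B * T = 98 * T + 14 / T₀ * T + 64 / (Δ₀ * η ^ 2) * T := by rw [hB]; ring
    linarith

/-! ### The one-point density and its regularity. -/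

/-- The one-point function as an explicit integral. -/
noncomputable def density (Δ : ℝ) (h : ℂ → ℝ) (Sig : Set ℂ) (β : ℝ) (m : ℕ) (t : ℂ) : ℝ≥0∞ :=
  (partitionFunction (potential Δ h Sig) β (m + 1))⁻¹ * ((m + 1 : ℕ) * siteDensity Δ h Sig β m t)

lemma setLIntegral_density {Δ : ℝ} {h : ℂ → ℝ} {Sig : Set ℂ} (hSig : IsCompact Sig)
    (hh : InnerProductSpace.HarmonicOnNhd h Sig) (β : ℝ) (m : ℕ) (s : Set ℂ) :
    ∫⁻ t in s, density Δ h Sig β m t ∂dA =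
      (partitionFunction (potential Δ h Sig) β (m + 1))⁻¹ *
        ((m + 1 : ℕ) * ∫⁻ t in s, siteDensity Δ h Sig β m t ∂dA) := by
  have := measurable_siteDensity (Δ := Δ) hSig hh β m
  simp only [density]
  rw [lintegral_const_mul _ (by fun_prop), lintegral_const_mul _ (by fun_prop)]

lemma diskDensity_eq {Δ : ℝ} {h : ℂ → ℝ} {Sig : Set ℂ} (hSig : IsCompact Sig)
    (hh : InnerProductSpace.HarmonicOnNhd h Sig) {β : ℝ} (hβ : 0 < β) (m : ℕ) (p : ℂ) (ε : ℝ) :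
    diskDensity (potential Δ h Sig) β (m + 1) p ε =
      (∫⁻ t in closedBall p ε, density Δ h Sig β m t ∂dA).toReal / ε ^ 2 := by
  rw [diskDensity, setLIntegral_density hSig hh, ← lintegral_particleCount hSig hh hβ,
    integral_eq_lintegral_of_nonneg_ae (Eventually.of_forall fun z => Nat.cast_nonneg _)
      (by
        have := (measurable_particleCount (n := m + 1) p ε).ennreal_toReal
        simp only [ENNReal.toReal_natCast] at this
        exact this.aestronglyMeasurable)]
  simp only [ENNReal.ofReal_natCast]

/-- The bounds for the site weight, integrated over the positions of the other particles. -/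
lemma density_lipschitz_aux {Δ : ℝ} {h : ℂ → ℝ} {Sig : Set ℂ} (hSig : IsCompact Sig)
    (hh : InnerProductSpace.HarmonicOnNhd h Sig) {β : ℝ} (hβ : 1 / 2 ≤ β) (hΔ : 0 ≤ Δ) {m : ℕ}
    {p : ℂ} {ρ r : ℝ} (hρ : ball p ρ ⊆ Sig) (hr : 0 < r) (hrρ : 2 * r < ρ)
    (hnr : (m + 1 : ℕ) * Δ * r ^ 2 ≤ 1) {t : ℂ} (ht : t ∈ ball p r) :
    density Δ h Sig β m p ≤ ENNReal.ofReal (Real.exp (4 * β) / r ^ 2) *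
        ∫⁻ z in closedBall p (2 * r), density Δ h Sig β m z ∂dA ∧
    density Δ h Sig β m t ≤ density Δ h Sig β m p +
      ENNReal.ofReal (5 * β * Real.exp (4 * β) / r ^ 3 * ‖t - p‖) *
        ∫⁻ z in closedBall p (2 * r), density Δ h Sig β m z ∂dA ∧
    density Δ h Sig β m p ≤ density Δ h Sig β m t +
      ENNReal.ofReal (5 * β * Real.exp (4 * β) / r ^ 3 * ‖t - p‖) *
        ∫⁻ z in closedBall p (2 * r), density Δ h Sig β m z ∂dA := by
  have hrw := measurable_restWeight (Δ := Δ) hSig hh β m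
  have hsw := fun y : Fin m → ℂ => siteWeight_lipschitz (Δ := Δ) hh hβ hΔ hρ hr hrρ hnr y ht
  -- The case `c = 0` gives the bound on the value, `c = 1` the two bounds on the oscillation.
  have key : ∀ (u v : ℂ) (c a : ℝ≥0∞), a ≠ ⊤ → c ≠ ⊤ →
      (∀ y : Fin m → ℂ, siteWeight Δ h Sig β y u ≤ c * siteWeight Δ h Sig β y v + a *
        ∫⁻ z in closedBall p (2 * r), siteWeight Δ h Sig β y z ∂dA) →
      density Δ h Sig β m u ≤ c * density Δ h Sig β m v + a *
        ∫⁻ z in closedBall p (2 * r), density Δ h Sig β m z ∂dA := by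
    intro u v c a ha hc H
    have h1 : siteDensity Δ h Sig β m u ≤ c * siteDensity Δ h Sig β m v + a *
        ∫⁻ z in closedBall p (2 * r), siteDensity Δ h Sig β m z ∂dA := by
      rw [setLIntegral_siteDensity hSig hh, siteDensity, siteDensity,
        ← lintegral_const_mul' _ _ ha, ← lintegral_const_mul' _ _ hc, ← lintegral_add_left]
      · refine lintegral_mono fun y => ?_
        rw [← mul_assoc, ← mul_assoc, ← add_mul]
        gcongr
        exact H y
      · have h2 : Measurable fun y : Fin m → ℂ => siteWeight Δ h Sig β y v :=
          (measurable_siteWeight (Δ := Δ) hSig hh β m).comp measurable_prodMk_left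
        fun_prop
    rw [setLIntegral_density hSig hh, density, density]
    calc _ ≤ (partitionFunction (potential Δ h Sig) β (m + 1))⁻¹ * ((m + 1 : ℕ) *
          (c * siteDensity Δ h Sig β m v + a *
            ∫⁻ z in closedBall p (2 * r), siteDensity Δ h Sig β m z ∂dA)) := by gcongr
      _ = _ := by ring
  refine ⟨?_, ?_, ?_⟩
  · simpa using key p p 0 _ ENNReal.ofReal_ne_top ENNReal.zero_ne_top
      fun y => by simpa using (hsw y).1
  · simpa using key t p 1 _ ENNReal.ofReal_ne_top ENNReal.one_ne_top
      fun y => by simpa using (hsw y).2.1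
  · simpa using key p t 1 _ ENNReal.ofReal_ne_top ENNReal.one_ne_top
      fun y => by simpa using (hsw y).2.2

/-- Dividing by the partition function `Z` uses only `Z⁻¹ * Z ≤ 1`, valid also for `Z = 0` or `Z =
∞`. -/
lemma setLIntegral_density_le {Δ Δ₀ η T₀ : ℝ} {h : ℂ → ℝ} {Sig : Set ℂ} (hSig : IsCompact Sig)
    (hh : InnerProductSpace.HarmonicOnNhd h Sig) {β : ℝ} (hβ : 1 / 2 ≤ β) (hΔ₀ : 0 < Δ₀)
    (hΔ : Δ₀ ≤ Δ) (hη : 0 < η) (hT₀ : 0 < T₀) (m : ℕ) {p : ℂ} (hp : ball p η ⊆ Sig)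
    {s : ℝ} (hs : 0 < s) (hT : T₀ ≤ (m + 1 : ℕ) * Δ * s ^ 2) :
    ∫⁻ t in closedBall p s, density Δ h Sig β m t ∂dA ≤
      ENNReal.ofReal ((98 + 14 / T₀ + 64 / (Δ₀ * η ^ 2)) * ((m + 1 : ℕ) * Δ * s ^ 2)) := by
  obtain ⟨j, hj⟩ := pow_unbounded_of_one_lt (η / s) (by norm_num : (1 : ℝ) < 8)
  have hj' : η ≤ 8 ^ (j + 1) * s := by
    rw [div_lt_iff₀ hs] at hj
    refine hj.le.trans ?_
    gcongr <;> norm_num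
  rw [setLIntegral_density hSig hh]
  calc _ ≤ (partitionFunction (potential Δ h Sig) β (m + 1))⁻¹ *
        (ENNReal.ofReal ((98 + 14 / T₀ + 64 / (Δ₀ * η ^ 2)) * ((m + 1 : ℕ) * Δ * s ^ 2)) *
        partitionFunction (potential Δ h Sig) β (m + 1)) := by
        exact mul_le_mul_right (count_le hSig hh hβ hΔ₀ hΔ hη hT₀ m hp j s hs hT hj') _
    _ = ENNReal.ofReal ((98 + 14 / T₀ + 64 / (Δ₀ * η ^ 2)) * ((m + 1 : ℕ) * Δ * s ^ 2)) *
        ((partitionFunction (potential Δ h Sig) β (m + 1))⁻¹ *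
          partitionFunction (potential Δ h Sig) β (m + 1)) := by ring
    _ ≤ _ := mul_le_of_le_one_right' (ENNReal.inv_mul_le_one _)

/-- Disk averages of a function that is Lipschitz at `p` converge to its value at `p`. -/
lemma tendsto_disk_average {R : ℂ → ℝ≥0∞} {p : ℂ} {r b : ℝ} (hr : 0 < r)
    (hb : 0 ≤ b) (hfin : R p ≠ ⊤)
    (hle : ∀ t ∈ ball p r, R t ≤ R p + ENNReal.ofReal (b * ‖t - p‖))
    (hge : ∀ t ∈ ball p r, R p ≤ R t + ENNReal.ofReal (b * ‖t - p‖)) :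
    Tendsto (fun ε : ℝ => (∫⁻ t in closedBall p ε, R t ∂dA).toReal / ε ^ 2) (𝓝[>] 0)
      (𝓝 (R p).toReal) := by
  have hev : ∀ᶠ ε : ℝ in 𝓝[>] 0, ε ∈ Ioo 0 r := Ioo_mem_nhdsGT hr
  have hbound : ∀ ε ∈ Ioo 0 r,
      |(∫⁻ t in closedBall p ε, R t ∂dA).toReal / ε ^ 2 - (R p).toReal| ≤ b * ε := by
    intro ε hε
    have hε0 : 0 < ε := hε.1
    have hsub : closedBall p ε ⊆ ball p r := closedBall_subset_ball hε.2
    have hn : ∀ t ∈ closedBall p ε, ENNReal.ofReal (b * ‖t - p‖) ≤ ENNReal.ofReal (b * ε) :=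
      fun t ht => by
        have : ‖t - p‖ ≤ ε := by rw [← dist_eq_norm]; exact ht
        gcongr
    -- The disk has `dA`-area exactly `ε²`, so the quotient is a true average.
    have h1 : ∫⁻ t in closedBall p ε, R t ∂dA ≤
        (R p + ENNReal.ofReal (b * ε)) * ENNReal.ofReal (ε ^ 2) := by
      rw [← dA_closedBall p hε0.le, ← setLIntegral_const]
      exact setLIntegral_mono' measurableSet_closedBall fun t ht =>
        (hle t (hsub ht)).trans (add_le_add_right (hn t ht) _)
    have h2 : R p * ENNReal.ofReal (ε ^ 2) ≤
        ∫⁻ t in closedBall p ε, R t ∂dA + ENNReal.ofReal (b * ε) * ENNReal.ofReal (ε ^ 2) := by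
      rw [← dA_closedBall p hε0.le, ← setLIntegral_const, ← setLIntegral_const,
        ← lintegral_add_right _ measurable_const]
      exact setLIntegral_mono' measurableSet_closedBall fun t ht =>
        (hge t (hsub ht)).trans (add_le_add_right (hn t ht) _)
    have hI : ∫⁻ t in closedBall p ε, R t ∂dA ≠ ⊤ := ne_top_of_le_ne_top
      (ENNReal.mul_ne_top (ENNReal.add_ne_top.2 ⟨hfin, ENNReal.ofReal_ne_top⟩)
        ENNReal.ofReal_ne_top) h1
    have h3 := ENNReal.toReal_mono (ENNReal.mul_ne_top (ENNReal.add_ne_top.2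
      ⟨hfin, ENNReal.ofReal_ne_top⟩) ENNReal.ofReal_ne_top) h1
    have h4 := ENNReal.toReal_mono (ENNReal.add_ne_top.2 ⟨hI, ENNReal.mul_ne_top
      ENNReal.ofReal_ne_top ENNReal.ofReal_ne_top⟩) h2
    rw [ENNReal.toReal_mul, ENNReal.toReal_add hfin ENNReal.ofReal_ne_top,
      ENNReal.toReal_ofReal (by positivity), ENNReal.toReal_ofReal (by positivity)] at h3
    rw [ENNReal.toReal_add hI (ENNReal.mul_ne_top ENNReal.ofReal_ne_top ENNReal.ofReal_ne_top),
      ENNReal.toReal_mul, ENNReal.toReal_mul, ENNReal.toReal_ofReal (by positivity),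
      ENNReal.toReal_ofReal (by positivity)] at h4
    rw [abs_le, neg_le_sub_iff_le_add, sub_le_iff_le_add, div_le_iff₀ (by positivity),
      ← sub_le_iff_le_add, le_div_iff₀ (by positivity)]
    constructor <;> linarith
  rw [tendsto_iff_norm_sub_tendsto_zero]
  have h0 : Tendsto (fun ε : ℝ => b * ε) (𝓝[>] 0) (𝓝 0) := by
    have : Tendsto (fun ε : ℝ => b * ε) (𝓝 0) (𝓝 (b * 0)) := (continuous_const_mul b).tendsto 0
    rw [mul_zero] at this
    exact this.mono_left nhdsWithin_le_nhds
  exact squeeze_zero' (Eventually.of_forall fun _ => norm_nonneg _) (hev.mono hbound) h0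

/-! ### Inner region, choice of constants and conclusion. -/

/-- The ball is connected and misses the frontier, so it cannot leave the interior. -/
lemma ball_infDist_frontier_subset {s : Set ℂ} {p : ℂ} (hp : p ∈ interior s) :
    ball p (infDist p (frontier s)) ⊆ interior s := by
  rcases (ball p (infDist p (frontier s))).eq_empty_or_nonempty with he | hne
  · rw [he]; exact empty_subset _
  have hconn : IsPreconnected (ball p (infDist p (frontier s))) :=
    (convex_ball p _).isPreconnected
  refine hconn.subset_left_of_subset_union isOpen_interior isClosed_closure.isOpen_compl
    (disjoint_compl_right.mono_left interior_subset_closure) (fun x hx => ?_)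
    ⟨p, mem_ball_self (nonempty_ball.1 hne), hp⟩
  by_contra hx'
  rw [mem_union, not_or, mem_compl_iff, not_not] at hx'
  have h1 := infDist_le_dist_of_mem (x := p) (show x ∈ frontier s from ⟨hx'.2, hx'.1⟩)
  rw [mem_ball, dist_comm] at hx
  linarith

/-- The limit defining the one-point function exists, and the one-point function is Lipschitz on
the microscopic scale. The constant depends only on the size of the disks contained in `Sig`:
`count_le` bounds the local number of particles without any information on the droplet. -/
lemma onePoint_equicontinuous {Δ₀ η₀ : ℝ} (hΔ₀ : 0 < Δ₀) (hη₀ : 0 < η₀) :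
    ∃ C : ℝ, 0 < C ∧ ∀ (Δ : ℝ) (h : ℂ → ℝ) (Sig : Set ℂ), Δ₀ ≤ Δ → IsCompact Sig →
      InnerProductSpace.HarmonicOnNhd h Sig → ∀ (β : ℝ) (n : ℕ), 1 / 2 ≤ β → 1 ≤ n →
      (∀ z ∈ innerRegion Sig η₀, Tendsto (diskDensity (potential Δ h Sig) β n z) (𝓝[>] 0)
        (𝓝 (onePoint (potential Δ h Sig) β n z))) ∧
      ∀ z ∈ innerRegion Sig η₀, ∀ w ∈ innerRegion Sig η₀,
        |onePoint (potential Δ h Sig) β n z - onePoint (potential Δ h Sig) β n w|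
          ≤ C ^ β * (n * Δ) * Real.sqrt (n * Δ) * ‖z - w‖ := by
  -- The microscopic radius will be `r = κ / √(nΔ)`: the first bound gives `n Δ r² ≤ 1`, the second
  -- `r ≤ η₀ / 3`.
  set κ : ℝ := min 1 (η₀ * Real.sqrt Δ₀ / 3) with hκ
  have hκ0 : 0 < κ := lt_min one_pos (by positivity)
  have hκ1 : κ ≤ 1 := min_le_left _ _
  -- The bound of `setLIntegral_density_le` at radius `2r`, where `n Δ (2r)² = 4κ²`.
  set A : ℝ := (98 + 14 / (4 * κ ^ 2) + 64 / (Δ₀ * η₀ ^ 2)) * (4 * κ ^ 2) with hA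
  have hA0 : 0 < A := by positivity
  set X : ℝ := max 1 (5 * A / κ ^ 3) with hX
  have hX1 : 1 ≤ X := le_max_left _ _
  have hX2 : 5 * A / κ ^ 3 ≤ X := le_max_right _ _
  -- In the power `β`, `X ^ (2β) ≥ X` absorbs `5A / κ³`, and `exp (5β)` absorbs `β * exp (4β)`.
  refine ⟨X ^ 2 * Real.exp 5, by positivity, fun Δ h Sig hΔ hSig hh β n hβ hn => ?_⟩
  obtain ⟨m, rfl⟩ : ∃ m, n = m + 1 := ⟨n - 1, by omega⟩
  have hβ0 : 0 < β := by linarith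
  have hΔ0 : 0 < Δ := hΔ₀.trans_le hΔ
  set ν : ℝ := (m + 1 : ℕ) * Δ with hν
  have hνΔ : Δ₀ ≤ ν := by
    have : (1 : ℝ) ≤ (m + 1 : ℕ) := by exact_mod_cast hn
    nlinarith
  have hν0 : 0 < ν := hΔ₀.trans_le hνΔ
  set q := Real.sqrt ν with hq
  have hq0 : 0 < q := Real.sqrt_pos.2 hν0
  have hqq : q ^ 2 = ν := Real.sq_sqrt hν0.le
  set r := κ / q with hr
  have hr0 : 0 < r := by positivity
  have hνr : ν * r ^ 2 = κ ^ 2 := by rw [hr, div_pow, hqq]; field_simp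
  have hrη : 2 * r < η₀ := by
    have h1 : Real.sqrt Δ₀ ≤ q := Real.sqrt_le_sqrt hνΔ
    have h2 : κ ≤ η₀ * q / 3 := (min_le_right _ _).trans (by gcongr)
    have h3 : r ≤ η₀ / 3 := by
      rw [hr, div_le_iff₀ hq0]
      linarith
    linarith
  have hC : (X ^ 2 * Real.exp 5) ^ β = X ^ (2 * β) * Real.exp (5 * β) := by
    rw [Real.mul_rpow (by positivity) (by positivity), ← Real.exp_mul, Real.rpow_mul (by linarith),
      Real.rpow_two]
  have hXβ : X ≤ X ^ (2 * β) := by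
    conv_lhs => rw [← Real.rpow_one X]
    exact Real.rpow_le_rpow_of_exponent_le hX1 (by linarith)
  have h5A : 5 * β * Real.exp (4 * β) * (A / κ ^ 3) ≤ (X ^ 2 * Real.exp 5) ^ β := by
    have h1 : β ≤ Real.exp β := by linarith [Real.add_one_le_exp β]
    have h2 : Real.exp (5 * β) = Real.exp β * Real.exp (4 * β) := by
      rw [← Real.exp_add]; ring_nf
    calc 5 * β * Real.exp (4 * β) * (A / κ ^ 3)
        = (5 * A / κ ^ 3) * (β * Real.exp (4 * β)) := by ring
      _ ≤ X ^ (2 * β) * (Real.exp β * Real.exp (4 * β)) := by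
        gcongr
        exact hX2.trans hXβ
      _ = _ := by rw [hC, h2]
  set L : ℝ := (X ^ 2 * Real.exp 5) ^ β * ν * q with hL
  have hL0 : 0 < L := by positivity
  have hr3 : (r ^ 3)⁻¹ = ν * q / κ ^ 3 := by
    rw [hr, ← hqq]; field_simp
  have hbL : 5 * β * Real.exp (4 * β) / r ^ 3 * A ≤ L := by
    calc 5 * β * Real.exp (4 * β) / r ^ 3 * A
        = 5 * β * Real.exp (4 * β) * (A / κ ^ 3) * (ν * q) := by
          rw [div_eq_mul_inv _ (r ^ 3), hr3]; ring
      _ ≤ (X ^ 2 * Real.exp 5) ^ β * (ν * q) := by gcongr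
      _ = L := by rw [hL]; ring
  have haL : Real.exp (4 * β) / r ^ 2 * A ≤ L * r := by
    have h1 : Real.exp (4 * β) / r ^ 2 * A = Real.exp (4 * β) / r ^ 3 * A * r := by field_simp
    have h2 : Real.exp (4 * β) ≤ 5 * β * Real.exp (4 * β) :=
      le_mul_of_one_le_left (by positivity) (by linarith)
    rw [h1]
    refine mul_le_mul_of_nonneg_right (le_trans ?_ hbL) hr0.le
    gcongr
  set R := density Δ h Sig β m with hR
  have hball : ∀ z ∈ innerRegion Sig η₀, ball z η₀ ⊆ Sig := fun z hz =>
    (ball_subset_ball hz.2).trans ((ball_infDist_frontier_subset hz.1).trans interior_subset)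
  have hN : ∀ z ∈ innerRegion Sig η₀,
      ∫⁻ t in closedBall z (2 * r), R t ∂dA ≤ ENNReal.ofReal A := fun z hz => by
    have hT : ν * (2 * r) ^ 2 = 4 * κ ^ 2 := by rw [← hνr]; ring
    have := setLIntegral_density_le (T₀ := 4 * κ ^ 2) hSig hh hβ hΔ₀ hΔ hη₀ (by positivity) m
      (hball z hz) (s := 2 * r) (by positivity) (by rw [← hν, hT])
    rwa [← hν, hT] at this
  have hnr : (m + 1 : ℕ) * Δ * r ^ 2 ≤ 1 := by
    rw [← hν, hνr]; exact pow_le_one₀ hκ0.le hκ1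
  have hsup : ∀ z ∈ innerRegion Sig η₀, R z ≤ ENNReal.ofReal (L * r) := fun z hz => by
    have h1 := (density_lipschitz_aux (Δ := Δ) hSig hh hβ hΔ0.le (hball z hz) hr0 hrη hnr
      (mem_ball_self hr0)).1
    refine h1.trans ((mul_le_mul_right (hN z hz) _).trans ?_)
    rw [← ENNReal.ofReal_mul (by positivity)]
    exact ENNReal.ofReal_le_ofReal haL
  have hfin : ∀ z ∈ innerRegion Sig η₀, R z ≠ ⊤ := fun z hz =>
    ne_top_of_le_ne_top ENNReal.ofReal_ne_top (hsup z hz)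
  have hosc : ∀ z : ℂ, z ∈ innerRegion Sig η₀ → ∀ t : ℂ,
      ENNReal.ofReal (5 * β * Real.exp (4 * β) / r ^ 3 * ‖t - z‖) *
        ∫⁻ t in closedBall z (2 * r), R t ∂dA ≤ ENNReal.ofReal (L * ‖t - z‖) := fun z hz t => by
    refine (mul_le_mul_right (hN z hz) _).trans ?_
    rw [← ENNReal.ofReal_mul (by positivity), mul_right_comm]
    gcongr
  have hle : ∀ z ∈ innerRegion Sig η₀, ∀ t ∈ ball z r,
      R t ≤ R z + ENNReal.ofReal (L * ‖t - z‖) := fun z hz t ht =>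
    (density_lipschitz_aux (Δ := Δ) hSig hh hβ hΔ0.le (hball z hz) hr0 hrη hnr ht).2.1.trans
      (by gcongr; exact hosc z hz t)
  have hge : ∀ z ∈ innerRegion Sig η₀, ∀ t ∈ ball z r,
      R z ≤ R t + ENNReal.ofReal (L * ‖t - z‖) := fun z hz t ht =>
    (density_lipschitz_aux (Δ := Δ) hSig hh hβ hΔ0.le (hball z hz) hr0 hrη hnr ht).2.2.trans
      (by gcongr; exact hosc z hz t)
  have hlim : ∀ z ∈ innerRegion Sig η₀,
      Tendsto (diskDensity (potential Δ h Sig) β (m + 1) z) (𝓝[>] 0) (𝓝 (R z).toReal) :=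
    fun z hz => by
      have := tendsto_disk_average hr0 hL0.le (hfin z hz) (hle z hz) (hge z hz)
      exact this.congr fun ε => (diskDensity_eq hSig hh hβ0 m z ε).symm
  have hone : ∀ z ∈ innerRegion Sig η₀,
      onePoint (potential Δ h Sig) β (m + 1) z = (R z).toReal := fun z hz =>
    (hlim z hz).limUnder_eq
  refine ⟨fun z hz => by rw [hone z hz]; exact hlim z hz, fun z hz w hw => ?_⟩
  rw [hone z hz, hone w hw]
  have htoReal : ∀ u ∈ innerRegion Sig η₀, ∀ v ∈ innerRegion Sig η₀, ∀ x : ℝ, 0 ≤ x →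
      R u ≤ R v + ENNReal.ofReal x → (R u).toReal ≤ (R v).toReal + x := fun u _ v hv x hx H => by
    have := ENNReal.toReal_mono (ENNReal.add_ne_top.2 ⟨hfin v hv, ENNReal.ofReal_ne_top⟩) H
    rwa [ENNReal.toReal_add (hfin v hv) ENNReal.ofReal_ne_top, ENNReal.toReal_ofReal hx] at this
  rw [abs_sub_le_iff]
  -- Nearby points use the local estimate. For points at distance at least `r`, both densities lie
  -- in `[0, L * r]`, so they differ by at most `L * ‖z - w‖`.
  by_cases hzw : z ∈ ball w r
  · have h1 := htoReal z hz w hw _ (by positivity) (hle w hw z hzw)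
    have h2 := htoReal w hw z hz _ (by positivity) (hge w hw z hzw)
    constructor <;> linarith
  · have hfar : L * r ≤ L * ‖z - w‖ := by
      rw [mem_ball, not_lt, dist_eq_norm] at hzw
      gcongr
    have h1 := ENNReal.toReal_le_of_le_ofReal (by positivity) (hsup z hz)
    have h2 := ENNReal.toReal_le_of_le_ofReal (by positivity) (hsup w hw)
    have h3 := ENNReal.toReal_nonneg (a := R z)
    have h4 := ENNReal.toReal_nonneg (a := R w)
    constructor <;> linarith

/-- A compact set, rescaled about a point well inside `Sig`, eventually lies well inside `Sig`. -/
lemma exists_rescaled_mem_innerRegion {Sig : Set ℂ} {Δ η : ℝ} (hΔ : 0 < Δ) (hη : 0 < η) {p : ℂ}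
    (hp : p ∈ interior Sig) (hpη : η < infDist p (frontier Sig)) {K : Set ℂ} (hK : IsCompact K) :
    ∃ n₀ : ℕ, ∀ n : ℕ, n₀ ≤ n → 1 ≤ n ∧ ∀ z ∈ K,
      p + z / (Real.sqrt (n * Δ) : ℂ) ∈ innerRegion Sig η := by
  obtain ⟨M, hM⟩ := hK.isBounded.exists_norm_le
  set δ := infDist p (frontier Sig) - η with hδ
  have hδ0 : 0 < δ := sub_pos.2 hpη
  -- From this `n₀` on, the displacement is at most `M / √(nΔ) ≤ δ`.
  obtain ⟨n₀, hn₀⟩ := exists_nat_ge ((M / δ) ^ 2 / Δ)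
  refine ⟨max 1 n₀, fun n hn => ⟨(le_max_left _ _).trans hn, fun z hz => ?_⟩⟩
  have hn1 : (1 : ℝ) ≤ n := by exact_mod_cast (le_max_left _ _).trans hn
  have hq0 : 0 < Real.sqrt (n * Δ) := Real.sqrt_pos.2 (by positivity)
  have h1 : M / δ ≤ Real.sqrt (n * Δ) := by
    apply Real.le_sqrt_of_sq_le
    rw [← div_le_iff₀ hΔ]
    exact hn₀.trans (by exact_mod_cast (le_max_right _ _).trans hn)
  have h2 : dist (p + z / (Real.sqrt (n * Δ) : ℂ)) p ≤ δ := by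
    rw [dist_self_add_left, norm_div, Complex.norm_real, Real.norm_of_nonneg hq0.le,
      div_le_iff₀ hq0]
    rw [div_le_iff₀ hδ0] at h1
    linarith [hM z hz]
  refine ⟨ball_infDist_frontier_subset hp (mem_ball.2 (by linarith)), ?_⟩
  have h3 := infDist_le_infDist_add_dist (s := frontier Sig) (x := p)
    (y := p + z / (Real.sqrt (n * Δ) : ℂ))
  rw [dist_comm] at h3
  linarith

end HeleShaw

theorem mainTheorem1 (Δ₀ η₀ : ℝ) (hΔ₀ : 0 < Δ₀) (hη₀ : 0 < η₀) :
    ∃ C : ℝ, 0 < C ∧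
      ∀ (Δ : ℝ) (h : ℂ → ℝ) (Sig : Set ℂ) (σ : Measure ℂ),
        Δ₀ ≤ Δ →
        IsCompact Sig →
        InnerProductSpace.HarmonicOnNhd h Sig →
        HeleShaw.IsEquilibriumMeasure (HeleShaw.potential Δ h Sig) σ →
        (∀ s ∈ σ.support, 2 * η₀ ≤ Metric.infDist s Sigᶜ) →
        -- the limit defining the one-point function exists, and the Lipschitz bound holds
        (∀ (β : ℝ) (n : ℕ), 1 / 2 ≤ β → 1 ≤ n →
          (∀ z ∈ HeleShaw.innerRegion Sig η₀,
            Tendsto (HeleShaw.diskDensity (HeleShaw.potential Δ h Sig) β n z) (𝓝[>] 0)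
              (𝓝 (HeleShaw.onePoint (HeleShaw.potential Δ h Sig) β n z))) ∧
          ∀ z ∈ HeleShaw.innerRegion Sig η₀, ∀ w ∈ HeleShaw.innerRegion Sig η₀,
            |HeleShaw.onePoint (HeleShaw.potential Δ h Sig) β n z
              - HeleShaw.onePoint (HeleShaw.potential Δ h Sig) β n w|
              ≤ C ^ β * (n * Δ) * Real.sqrt (n * Δ) * ‖z - w‖) ∧
        -- the rescaled one-point functions are uniformly Lipschitz on compact sets
        (∀ p ∈ interior Sig, η₀ < Metric.infDist p (frontier Sig) →
          ∀ K : Set ℂ, IsCompact K → ∃ n₀ : ℕ, ∀ n : ℕ, n₀ ≤ n → ∀ β : ℝ, 1 / 2 ≤ β →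
            ∀ z ∈ K, ∀ w ∈ K,
              |HeleShaw.rescaledOnePoint (HeleShaw.potential Δ h Sig) Δ β n p z
                - HeleShaw.rescaledOnePoint (HeleShaw.potential Δ h Sig) Δ β n p w|
                ≤ C ^ β * ‖z - w‖) := by
  obtain ⟨C, hC, H⟩ := HeleShaw.onePoint_equicontinuous hΔ₀ hη₀
  refine ⟨C, hC, fun Δ h Sig σ hΔ hSig hh _ _ => ⟨H Δ h Sig hΔ hSig hh, ?_⟩⟩
  intro p hp hpη K hK
  have hΔ0 : 0 < Δ := hΔ₀.trans_le hΔ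
  obtain ⟨n₀, hn₀⟩ := HeleShaw.exists_rescaled_mem_innerRegion hΔ0 hη₀ hp hpη hK
  refine ⟨n₀, fun n hn β hβ z hz w hw => ?_⟩
  obtain ⟨hn1, hmem⟩ := hn₀ n hn
  have hν : 0 < n * Δ := by
    have : (0 : ℝ) < n := by exact_mod_cast hn1
    positivity
  have hq : 0 < Real.sqrt (n * Δ) := Real.sqrt_pos.2 hν
  have h1 := (H Δ h Sig hΔ hSig hh β n hβ hn1).2 _ (hmem z hz) _ (hmem w hw)
  -- Rescaling divides the distance by `√(nΔ)` and the density by `nΔ`, which cancels the factor `nΔ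
  -- √(nΔ)`.
  rw [add_sub_add_left_eq_sub, ← sub_div, norm_div, Complex.norm_real,
    Real.norm_of_nonneg hq.le] at h1
  rw [HeleShaw.rescaledOnePoint, HeleShaw.rescaledOnePoint, ← sub_div, abs_div, abs_of_pos hν,
    div_le_iff₀ hν]
  refine h1.trans_eq ?_
  field_simp
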